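/- Hilbert spaces are complex, separable and possibly infinite-dimensional. On a bipartite system $AB$ let $X\mapsto X^\Gamma$ be the partial transpose on $B$ in fixed orthonormal bases, let $\mathcal S_{AB}$ be the cone generated by the trace-norm closed convex hull of the pure product states, and let $\mathcal{PPT}_{AB}$ be the cone of positive trace-class operators $T$ with $T^\Gamma\ge 0$. Let $\mathcal K$ be one of these two cones (the same choice on every bipartite system). For states $\rho,\omega$ put $$R^s_{\mathcal K}(\rho)=\inf\{\operatorname{Tr}\delta:\ \delta\in\mathcal K,\ \rho+\delta\in\mathcal K\},\qquad N(\rho)=\tfrac12\big(\|\rho^\Gamma\|_1-1\big),$$ $$1+2R^\tau_{\mathcal K}(\rho|\omega)=\sup\{\operatorname{Tr}X\rho:\ X=X^\dagger \text{ bounded},\ |\operatorname{Tr}XW|\le\operatorname{Tr}W\ \ \forall W\in\mathcal K,\ \|X\|_\infty=\operatorname{Tr}X\omega\},$$ $$N_\tau(\rho|\omega)=\sup\{\operatorname{Tr}X\rho:\ X=X^\dagger \text{ bounded},\ \|X^\Gamma\|_\infty\le1,\ \|X\|_\infty=\operatorname{Tr}X\omega\},$$ $R^\tau_{\mathcal K}(\rho)=R^\tau_{\mathcal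 K}(\rho|\rho)$, $E^\tau_N(\rho)=\log_2N_\tau(\rho|\rho)$ and $L^\tau_{\mathcal K}(\rho)=\limsup_{n\to\infty}\frac1n\log_2\big(1+R^\tau_{\mathcal K}(\rho^{\otimes n})\big)$, all with values in the extended real line. For $\delta\ge 0$ and $M=R^s_{\mathcal K}$ or $M=N$, let $\mathrm{KP}^M_\delta(AB\to A'B')$ be the set of positive trace-preserving linear maps $\Lambda$ from the trace-class operators on $AB$ to those on $A'B'$ such that $M(\Lambda(\sigma))\le\delta$ for all states $\sigma\in\mathcal K_{AB}$. For a sequence $\delta_n\ge0$ and $\epsilon\in[0,1)$ let $$E^{\epsilon}_{c,\mathrm{KP}^M_{(\delta_n)}}(\rho)=\inf\Big\{R>0:\ \limsup_{n\to\infty}\ \inf_{\Lambda_n\in \mathrm{KP}^M_{\delta_n}(A_0^{\lfloor Rn\rfloor}B_0^{\lfloor Rn\rfloor}\to A^nB^n)}\tfrac12\big\|\Lambda_n(\Phi_2^{\otimes\lfloor Rn\rfloor})-\rho^{\otimes n}\big\|_1\le\epsilon\Big\},$$ where $A_0B_0$ is a two-qubit system, $\Phi_2=|\Phi_2\rangle\langle\Phi_2|$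 and $|\Phi_2\rangle=\frac1{\sqrt2}(|00\rangle+|11\rangle)$. Write $\mathrm{KP}^s$ for $M=R^s_{\mathcal K}$ and $\mathrm{KP}^N$ for $M=N$. Theorem. Let $\mathcal K=\mathcal S$ or $\mathcal K=\mathcal{PPT}$, let $\rho$ be a state of a bipartite system $AB$, and let $(\delta_n)_n$ be a sequence of non-negative numbers with $\delta_n=2^{o(n)}$, i.e. for every $k>0$ there is $m$ with $\delta_n<2^{kn}$ for all $n\ge m$. Then $$\inf_{\epsilon\in[0,1/2)}E^\epsilon_{c,\mathrm{KP}^s_{(\delta_n)}}(\rho)\ \ge\ L^\tau_{\mathcal K}(\rho)\ \ge\ E^\tau_N(\rho)\qquad\text{and}\qquad \inf_{\epsilon\in[0,1/2)}E^\epsilon_{c,\mathrm{KP}^N_{(\delta_n)}}(\rho)\ \ge\ E^\tau_N(\rho).$$ -/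

import Mathlib

open scoped ENNReal InnerProductSpace

noncomputable section

namespace Ent

section Modulus

variable {A : Type*} [CStarAlgebra A] [PartialOrder A] [StarOrderedRing A]

/-- The modulus `|T| = √(T† T)` of an element of a C*-algebra, in particular of a bounded operator. -/
def absOp (T : A) : A := CFC.sqrt (star T * T)

theorem absOp_nonneg (T : A) : 0 ≤ absOp T := CFC.sqrt_nonneg _

theorem absOp_mul_absOp (T : A) : absOp T * absOp T = star T * T :=
  CFC.sqrt_mul_sqrt_self _ (star_mul_self_nonneg T)

theorem star_absOp (T : A) : star (absOp T) = absOp T :=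
  (absOp_nonneg T).isSelfAdjoint

theorem absOp_zero : absOp (0 : A) = 0 := by simp [absOp]

theorem absOp_smul (c : ℂ) (T : A) : absOp (c • T) = ((‖c‖ : ℝ) : ℂ) • absOp T := by
  rw [Complex.coe_smul]
  exact CFC.abs_smul c T

/-- The square root of the modulus. -/
def sqrtAbs (T : A) : A := CFC.sqrt (absOp T)

theorem star_sqrtAbs (T : A) : star (sqrtAbs T) = sqrtAbs T :=
  (CFC.sqrt_nonneg (absOp T)).isSelfAdjoint

theorem sqrtAbs_mul_sqrtAbs (T : A) : sqrtAbs T * sqrtAbs T = absOp T :=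
  CFC.sqrt_mul_sqrt_self _ (absOp_nonneg T)

end Modulus

section Operators

theorem tsum_inner_sq {H : Type*} [NormedAddCommGroup H] [InnerProductSpace ℂ H] {ι : Type*}
    (b : HilbertBasis ι ℂ H) (x : H) :
    ∑' i, ENNReal.ofReal (‖⟪b i, x⟫_ℂ‖ ^ 2) = ENNReal.ofReal (‖x‖ ^ 2) := by
  have h := b.hasSum_inner_mul_inner x x
  have h' : HasSum (fun i => ‖⟪b i, x⟫_ℂ‖ ^ 2) (‖x‖ ^ 2) := by
    have := Complex.hasSum_re h
    convert this using 1
    · ext i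
      rw [← inner_conj_symm x (b i), Complex.conj_mul']
      norm_cast
    · exact norm_sq_eq_re_inner (𝕜 := ℂ) x
  rw [← h'.tsum_eq, ENNReal.ofReal_tsum_of_nonneg (fun _ => sq_nonneg _) h'.summable]

variable {H : Type*} [NormedAddCommGroup H] [InnerProductSpace ℂ H] [CompleteSpace H]
  {ι : Type*}

theorem norm_abs_apply (T : H →L[ℂ] H) (x : H) : ‖absOp T x‖ = ‖T x‖ := by
  have hsa : star (absOp T) = absOp T := star_absOp T
  have h1 : ‖absOp T x‖ ^ 2 = ‖T x‖ ^ 2 := by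
    rw [(absOp T).apply_norm_sq_eq_inner_adjoint_left, T.apply_norm_sq_eq_inner_adjoint_left,
      ← ContinuousLinearMap.star_eq_adjoint, ← ContinuousLinearMap.star_eq_adjoint, hsa,
      ← ContinuousLinearMap.mul_def, ← ContinuousLinearMap.mul_def, absOp_mul_absOp]
  exact (sq_eq_sq₀ (norm_nonneg _) (norm_nonneg _)).1 h1

theorem inner_abs_abs (T : H →L[ℂ] H) (x y : H) :
    ⟪absOp T x, absOp T y⟫_ℂ = ⟪T x, T y⟫_ℂ := by
  have hsa : star (absOp T) = absOp T := star_absOp T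
  rw [← ContinuousLinearMap.adjoint_inner_right, ← ContinuousLinearMap.adjoint_inner_right,
    ← ContinuousLinearMap.star_eq_adjoint, ← ContinuousLinearMap.star_eq_adjoint, hsa]
  exact congrArg (fun S : H →L[ℂ] H => ⟪x, S y⟫_ℂ) (absOp_mul_absOp T)

theorem exists_resolvent (A : H →L[ℂ] H) (h : 0 ≤ A) (ε : ℝ) (hε : 0 < ε) :
    ∃ R : H →L[ℂ] H, (∀ x, A (R x) + (ε : ℂ) • R x = x) ∧ (∀ x, R (A x + (ε : ℂ) • x) = x) ∧
      ∀ x, ‖A (R x)‖ ≤ ‖x‖ := by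
  have hu : IsUnit (A + (ε : ℂ) • (1 : H →L[ℂ] H)) := by
    have h0 : (0 : H →L[ℂ] H) ≤ (ε : ℂ) • (1 : H →L[ℂ] H) := by
      rw [Complex.coe_smul]
      exact smul_nonneg hε.le zero_le_one
    have : IsStrictlyPositive ((ε : ℂ) • (1 : H →L[ℂ] H)) := by
      refine IsUnit.isStrictlyPositive ?_ h0
      exact (isUnit_one).smul (Units.mk0 (ε : ℂ) (by exact_mod_cast hε.ne'))
    exact (this.nonneg_add h).isUnit
  obtain ⟨u, hu⟩ := hu
  have e1 : ∀ x, A ((↑u⁻¹ : H →L[ℂ] H) x) + (ε : ℂ) • (↑u⁻¹ : H →L[ℂ] H) x = x := by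
    intro x
    have := congrArg (fun S : H →L[ℂ] H => S x) u.mul_inv
    simpa [hu] using this
  have e2 : ∀ x, (↑u⁻¹ : H →L[ℂ] H) (A x + (ε : ℂ) • x) = x := by
    intro x
    have := congrArg (fun S : H →L[ℂ] H => S x) u.inv_mul
    simpa [hu] using this
  refine ⟨↑u⁻¹, e1, e2, fun x => ?_⟩
  set y := (↑u⁻¹ : H →L[ℂ] H) x
  have hx : A y + (ε : ℂ) • y = x := e1 x
  have hpos : 0 ≤ (⟪A y, y⟫_ℂ).re :=
    ((ContinuousLinearMap.nonneg_iff_isPositive A).1 h).re_inner_nonneg_left y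
  have hsq : ‖A y‖ ^ 2 ≤ ‖x‖ ^ 2 := by
    rw [← hx, norm_add_sq (𝕜 := ℂ), inner_smul_right]
    have : RCLike.re ((ε : ℂ) * ⟪A y, y⟫_ℂ) = ε * (⟪A y, y⟫_ℂ).re := by
      simp
    rw [this]
    have := mul_nonneg hε.le hpos
    nlinarith [sq_nonneg ‖(ε : ℂ) • y‖]
  exact (sq_le_sq₀ (norm_nonneg _) (norm_nonneg _)).1 hsq

theorem exists_contraction (T : H →L[ℂ] H) (ε : ℝ) (hε : 0 < ε) :
    ∃ W : H →L[ℂ] H, (∀ x, ‖W x‖ ≤ ‖x‖) ∧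
      (∀ x, T x = W (absOp T x) + (ε : ℂ) • W x) ∧
      ∀ x, (⟪x, absOp T x⟫_ℂ).re ≤ ‖⟪W x, T x⟫_ℂ‖ + ε * ‖x‖ ^ 2 := by
  obtain ⟨R, h1, h2, h3⟩ := exists_resolvent (absOp T) (absOp_nonneg T) ε hε
  have hsa : (absOp T).IsSymmetric :=
    ((ContinuousLinearMap.nonneg_iff_isPositive _).1 (absOp_nonneg T)).isSymmetric
  refine ⟨T * R, fun x => ?_, fun x => ?_, fun x => ?_⟩
  · simpa [← norm_abs_apply T (R x)] using h3 x
  · have := congrArg T (h2 x)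
    rw [map_add, map_smul] at this
    simpa using this.symm
  · have key : ⟪x, absOp T x⟫_ℂ = ⟪T (R x), T x⟫_ℂ + ε * ⟪absOp T (R x), x⟫_ℂ := by
      have h := congrArg (fun z => ⟪z, absOp T x⟫_ℂ) (h1 x)
      simp only [inner_add_left, inner_smul_left, inner_abs_abs, Complex.conj_ofReal] at h
      rw [← h]
      congr 2
      exact (hsa (R x) x).symm
    rw [key, Complex.add_re]
    refine add_le_add (Complex.re_le_norm _) ((Complex.re_le_norm _).trans ?_)
    rw [norm_mul, Complex.norm_real, Real.norm_of_nonneg hε.le]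
    refine mul_le_mul_of_nonneg_left ?_ hε.le
    calc _ ≤ ‖absOp T (R x)‖ * ‖x‖ := norm_inner_le_norm _ _
      _ ≤ ‖x‖ * ‖x‖ := by gcongr; exact h3 x
      _ = _ := (sq _).symm

theorem re_inner_abs (T : H →L[ℂ] H) (x : H) :
    (⟪x, absOp T x⟫_ℂ).re = ‖sqrtAbs T x‖ ^ 2 := by
  have hs : star (sqrtAbs T) = sqrtAbs T :=
    star_sqrtAbs T
  rw [ContinuousLinearMap.apply_norm_sq_eq_inner_adjoint_right,
    ← ContinuousLinearMap.star_eq_adjoint, hs, ← ContinuousLinearMap.mul_def,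
    sqrtAbs_mul_sqrtAbs T]
  rfl


theorem tsum_comp_contraction_le (b : HilbertBasis ι ℂ H) (B C : H →L[ℂ] H)
    (hB : star B = B) (hC : ‖C‖ ≤ 1) :
    ∑' i, ENNReal.ofReal (‖B (C (b i))‖ ^ 2) ≤ ∑' i, ENNReal.ofReal (‖B (b i)‖ ^ 2) := by
  have h1 : ∀ i, ENNReal.ofReal (‖B (C (b i))‖ ^ 2)
      = ∑' j, ENNReal.ofReal (‖⟪b j, B (C (b i))⟫_ℂ‖ ^ 2) := fun i => (tsum_inner_sq b _).symm
  simp_rw [h1]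
  rw [ENNReal.tsum_comm]
  refine ENNReal.tsum_le_tsum fun j => ?_
  have h2 : ∀ i, ‖⟪b j, B (C (b i))⟫_ℂ‖ = ‖⟪b i, star C (B (b j))⟫_ℂ‖ := by
    intro i
    rw [← ContinuousLinearMap.adjoint_inner_left, ← ContinuousLinearMap.star_eq_adjoint, hB,
      ← ContinuousLinearMap.adjoint_inner_left, ← ContinuousLinearMap.star_eq_adjoint,
      norm_inner_symm]
  simp_rw [h2]
  rw [tsum_inner_sq]
  refine ENNReal.ofReal_le_ofReal ?_
  gcongr
  calc ‖star C (B (b j))‖ ≤ ‖star C‖ * ‖B (b j)‖ := ContinuousLinearMap.le_opNorm _ _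
    _ ≤ 1 * ‖B (b j)‖ := by gcongr; rwa [norm_star]
    _ = _ := one_mul _

theorem sum_inner_le (b : HilbertBasis ι ℂ H) (T U : H →L[ℂ] H) (hU : ∀ x, ‖U x‖ ≤ ‖x‖)
    (F : Finset ι) :
    ∑ i ∈ F, ENNReal.ofReal ‖⟪U (b i), T (b i)⟫_ℂ‖
      ≤ ∑' i, ENNReal.ofReal (⟪b i, absOp T (b i)⟫_ℂ).re := by
  have hs : star (sqrtAbs T) = sqrtAbs T :=
    star_sqrtAbs T
  have hUn : ‖U‖ ≤ 1 := ContinuousLinearMap.opNorm_le_bound _ zero_le_one (by simpa using hU)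
  refine ENNReal.le_of_forall_pos_le_add fun η hη _ => ?_
  set ε : ℝ := η / (F.card + 1) with hεd
  have hε : 0 < ε := by positivity
  obtain ⟨W, hW1, hW2, -⟩ := exists_contraction T ε hε
  have hWn : ‖W‖ ≤ 1 := ContinuousLinearMap.opNorm_le_bound _ zero_le_one (by simpa using hW1)
  set B := sqrtAbs T with hB
  set C := star W * U with hC
  have hCn : ‖C‖ ≤ 1 := (norm_mul_le _ _).trans (by
    rw [norm_star]; exact mul_le_one₀ hWn (norm_nonneg _) hUn)
  have hBB : ∀ x, B (B x) = absOp T x := fun x =>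
    congrArg (fun S : H →L[ℂ] H => S x) (sqrtAbs_mul_sqrtAbs T)
  have hterm : ∀ i, ENNReal.ofReal ‖⟪U (b i), T (b i)⟫_ℂ‖ ≤
      (ENNReal.ofReal (‖B (C (b i))‖ ^ 2) + ENNReal.ofReal (‖B (b i)‖ ^ 2)) / 2
        + ENNReal.ofReal ε := by
    intro i
    have hb : ‖b i‖ = 1 := b.orthonormal.1 i
    have e1 : ⟪U (b i), T (b i)⟫_ℂ
        = ⟪B (C (b i)), B (b i)⟫_ℂ + ε * ⟪U (b i), W (b i)⟫_ℂ := by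
      rw [hW2 (b i), inner_add_right, inner_smul_right, ← hBB,
        ← ContinuousLinearMap.adjoint_inner_left, ← ContinuousLinearMap.star_eq_adjoint]
      congr 1
      rw [← ContinuousLinearMap.adjoint_inner_left, ← ContinuousLinearMap.star_eq_adjoint, hs]
      rfl
    have e2 : ‖⟪U (b i), T (b i)⟫_ℂ‖ ≤ (‖B (C (b i))‖ ^ 2 + ‖B (b i)‖ ^ 2) / 2 + ε := by
      rw [e1]
      refine (norm_add_le _ _).trans (add_le_add ?_ ?_)
      · refine (norm_inner_le_norm _ _).trans ?_
        nlinarith [sq_nonneg (‖B (C (b i))‖ - ‖B (b i)‖)]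
      · rw [norm_mul, Complex.norm_real, Real.norm_of_nonneg hε.le]
        have : ‖⟪U (b i), W (b i)⟫_ℂ‖ ≤ 1 := (norm_inner_le_norm _ _).trans
          (mul_le_one₀ ((hU _).trans hb.le) (norm_nonneg _) ((hW1 _).trans hb.le))
        nlinarith
    refine (ENNReal.ofReal_le_ofReal e2).trans ?_
    rw [ENNReal.ofReal_add (by positivity) hε.le, ENNReal.ofReal_div_of_pos two_pos,
      ENNReal.ofReal_add (by positivity) (by positivity), ENNReal.ofReal_ofNat]
  have htot : ∑' i, ENNReal.ofReal (⟪b i, absOp T (b i)⟫_ℂ).re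
      = ∑' i, ENNReal.ofReal (‖B (b i)‖ ^ 2) := by simp_rw [re_inner_abs]; rfl
  rw [htot]
  calc _ ≤ ∑ i ∈ F, ((ENNReal.ofReal (‖B (C (b i))‖ ^ 2) + ENNReal.ofReal (‖B (b i)‖ ^ 2)) / 2
        + ENNReal.ofReal ε) := Finset.sum_le_sum fun i _ => hterm i
    _ = (∑ i ∈ F, ENNReal.ofReal (‖B (C (b i))‖ ^ 2)
          + ∑ i ∈ F, ENNReal.ofReal (‖B (b i)‖ ^ 2)) / 2 + F.card * ENNReal.ofReal ε := by
        simp [Finset.sum_add_distrib, div_eq_mul_inv, ← Finset.sum_mul]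
    _ ≤ (∑' i, ENNReal.ofReal (‖B (b i)‖ ^ 2) + ∑' i, ENNReal.ofReal (‖B (b i)‖ ^ 2)) / 2
          + η := by
        gcongr
        · exact (ENNReal.sum_le_tsum F).trans (tsum_comp_contraction_le b B C hs hCn)
        · exact ENNReal.sum_le_tsum F
        · rw [← ENNReal.ofReal_natCast, ← ENNReal.ofReal_mul (by positivity),
            ← ENNReal.ofReal_coe_nnreal]
          refine ENNReal.ofReal_le_ofReal ?_
          rw [hεd, mul_div_assoc', div_le_iff₀ (by positivity)]
          nlinarith [η.2]
    _ = _ := by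
        rw [← two_mul, mul_comm, mul_div_assoc, ENNReal.div_self two_ne_zero ENNReal.ofNat_ne_top,
          mul_one]

theorem tsum_abs_add_le (b : HilbertBasis ι ℂ H) (S T : H →L[ℂ] H) :
    ∑' i, ENNReal.ofReal (⟪b i, absOp (S + T) (b i)⟫_ℂ).re
      ≤ ∑' i, ENNReal.ofReal (⟪b i, absOp S (b i)⟫_ℂ).re
        + ∑' i, ENNReal.ofReal (⟪b i, absOp T (b i)⟫_ℂ).re := by
  conv_lhs => rw [ENNReal.tsum_eq_iSup_sum]
  refine iSup_le fun F => ?_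
  refine ENNReal.le_of_forall_pos_le_add fun η hη _ => ?_
  set ε : ℝ := η / (F.card + 1) with hεd
  have hε : 0 < ε := by positivity
  obtain ⟨W, hW1, -, hW3⟩ := exists_contraction (S + T) ε hε
  have hterm : ∀ i, ENNReal.ofReal (⟪b i, absOp (S + T) (b i)⟫_ℂ).re ≤
      ENNReal.ofReal ‖⟪W (b i), S (b i)⟫_ℂ‖ + ENNReal.ofReal ‖⟪W (b i), T (b i)⟫_ℂ‖
        + ENNReal.ofReal ε := by
    intro i
    have hb : ‖b i‖ = 1 := b.orthonormal.1 i
    rw [← ENNReal.ofReal_add (norm_nonneg _) (norm_nonneg _),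
      ← ENNReal.ofReal_add (by positivity) hε.le]
    refine ENNReal.ofReal_le_ofReal ((hW3 (b i)).trans ?_)
    rw [hb, one_pow, mul_one, add_apply, inner_add_right]
    gcongr
    exact norm_add_le _ _
  calc _ ≤ ∑ i ∈ F, (ENNReal.ofReal ‖⟪W (b i), S (b i)⟫_ℂ‖
        + ENNReal.ofReal ‖⟪W (b i), T (b i)⟫_ℂ‖ + ENNReal.ofReal ε) :=
        Finset.sum_le_sum fun i _ => hterm i
    _ = ∑ i ∈ F, ENNReal.ofReal ‖⟪W (b i), S (b i)⟫_ℂ‖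
        + ∑ i ∈ F, ENNReal.ofReal ‖⟪W (b i), T (b i)⟫_ℂ‖ + F.card * ENNReal.ofReal ε := by
        simp [Finset.sum_add_distrib]
    _ ≤ _ := by
        gcongr
        · exact sum_inner_le b S W hW1 F
        · exact sum_inner_le b T W hW1 F
        · rw [← ENNReal.ofReal_natCast, ← ENNReal.ofReal_mul (by positivity),
            ← ENNReal.ofReal_coe_nnreal]
          refine ENNReal.ofReal_le_ofReal ?_
          rw [hεd, mul_div_assoc', div_le_iff₀ (by positivity)]
          nlinarith [η.2]

end Operators

section Spaces

variable {ι : Type*}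

/-- The Hilbert space `ℓ²(ι)`: a Hilbert space with a fixed orthonormal basis indexed by `ι`. -/
def Hilb (ι : Type*) : Type _ := lp (fun _ : ι => ℂ) 2

instance : NormedAddCommGroup (Hilb ι) :=
  inferInstanceAs (NormedAddCommGroup (lp (fun _ : ι => ℂ) 2))

instance : InnerProductSpace ℂ (Hilb ι) :=
  inferInstanceAs (InnerProductSpace ℂ (lp (fun _ : ι => ℂ) 2))

instance : CompleteSpace (Hilb ι) :=
  inferInstanceAs (CompleteSpace (lp (fun _ : ι => ℂ) 2))

/-- The standard basis of `ℓ²(ι)`. -/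
def ket (ι : Type*) : HilbertBasis ι ℂ (Hilb ι) :=
  HilbertBasis.ofRepr (LinearIsometryEquiv.refl ℂ (lp (fun _ : ι => ℂ) 2))

/-- The coordinates of a vector of `ℓ²(ι)`. -/
def coord (x : Hilb ι) : ι → ℂ := (show lp (fun _ : ι => ℂ) 2 from x)

theorem coord_eq_inner (x : Hilb ι) (i : ι) : coord x i = ⟪ket ι i, x⟫_ℂ :=
  (ket ι).repr_apply_apply x i

/-- A square-summable family, as a vector of `ℓ²(ι)`. -/
def vecOf (f : ι → ℂ) (hf : Summable fun i => ‖f i‖ ^ 2) : Hilb ι :=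
  (⟨f, memℓp_gen (by simpa using hf)⟩ : lp (fun _ : ι => ℂ) 2)

theorem coord_vecOf (f : ι → ℂ) (hf : Summable fun i => ‖f i‖ ^ 2) : coord (vecOf f hf) = f :=
  rfl

theorem summable_coord (x : Hilb ι) : Summable fun i => ‖coord x i‖ ^ 2 := by
  have := (lp.memℓp (show lp (fun _ : ι => ℂ) 2 from x)).summable (by simp)
  simp only [ENNReal.toReal_ofNat, Real.rpow_ofNat] at this
  exact this

theorem hasSum_coord_sq (x : Hilb ι) : HasSum (fun i => ‖coord x i‖ ^ 2) (‖x‖ ^ 2) := by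
  have := lp.hasSum_norm (p := 2) (by simp) (show lp (fun _ : ι => ℂ) 2 from x)
  simp only [ENNReal.toReal_ofNat, Real.rpow_ofNat] at this
  exact this

/-- Bounded operators on `ℓ²(ι)`. -/
abbrev Op (ι : Type*) : Type _ := Hilb ι →L[ℂ] Hilb ι

/-- The matrix element `⟨i|T|j⟩`. -/
def entry (T : Op ι) (i j : ι) : ℂ := ⟪ket ι i, T (ket ι j)⟫_ℂ

theorem ext_entry {S T : Op ι} (h : ∀ i j, entry S i j = entry T i j) : S = T := by
  have h1 : ∀ j, S (ket ι j) = T (ket ι j) := by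
    intro j
    apply (ket ι).repr.injective
    ext i
    rw [(ket ι).repr_apply_apply, (ket ι).repr_apply_apply]
    exact h i j
  refine ContinuousLinearMap.ext_on
    (Submodule.dense_iff_topologicalClosure_eq_top.2 (ket ι).dense_span) ?_
  rintro _ ⟨j, rfl⟩
  exact h1 j

/-- The bounded operator with a prescribed matrix (`0` if there is no such operator). -/
def ofMatrix (m : ι → ι → ℂ) : Op ι :=
  open Classical in
  if h : ∃ T : Op ι, ∀ i j, entry T i j = m i j then h.choose else 0

/-- The trace norm `‖T‖₁ = ∑ᵢ ⟨i| |T| |i⟩`, in `[0, ∞]`. -/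
def traceNorm (T : Op ι) : ℝ≥0∞ := ∑' i, ENNReal.ofReal (entry (absOp T) i i).re

theorem traceNorm_zero : traceNorm (0 : Op ι) = 0 := by
  simp [traceNorm, absOp_zero, entry]

theorem traceNorm_add_le (S T : Op ι) : traceNorm (S + T) ≤ traceNorm S + traceNorm T :=
  tsum_abs_add_le (ket ι) S T

theorem traceNorm_smul (c : ℂ) (T : Op ι) :
    traceNorm (c • T) = ENNReal.ofReal ‖c‖ * traceNorm T := by
  simp only [traceNorm, absOp_smul, entry, ← ENNReal.tsum_mul_left]
  refine tsum_congr fun i => ?_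
  rw [← ENNReal.ofReal_mul (norm_nonneg c)]
  simp

/-- The space of trace-class operators. -/
def TraceClass (ι : Type*) : Submodule ℂ (Op ι) where
  carrier := {T | traceNorm T < ⊤}
  zero_mem' := by simp [traceNorm_zero]
  add_mem' := fun {S T} hS hT =>
    (traceNorm_add_le S T).trans_lt (ENNReal.add_lt_top.2 ⟨hS, hT⟩)
  smul_mem' := fun c T hT => by
    simp only [Set.mem_ofPred_eq, traceNorm_smul]
    exact ENNReal.mul_lt_top ENNReal.ofReal_lt_top hT

theorem mem_traceClass_of_finite [Finite ι] (T : Op ι) : T ∈ TraceClass ι := by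
  have := Fintype.ofFinite ι
  change traceNorm T < ⊤
  rw [traceNorm, tsum_fintype]
  exact ENNReal.sum_lt_top.2 fun i _ => ENNReal.ofReal_lt_top

/-- The trace `∑ᵢ ⟨i|T|i⟩`; it is used for trace-class operators only. -/
def tr (T : Op ι) : ℂ := ∑' i, entry T i i

/-- Density operators: positive trace-class operators with unit trace. -/
def IsState (ρ : Op ι) : Prop := 0 ≤ ρ ∧ ρ ∈ TraceClass ι ∧ tr ρ = 1

theorem exists_op_of_summable (m : ι → ι → ℂ)
    (hm : Summable fun p : ι × ι => ‖m p.1 p.2‖ ^ 2) :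
    ∃ T : Op ι, ∀ i j, entry T i j = m i j := by
  have hrow : ∀ i, Summable fun j => ‖star (m i j)‖ ^ 2 := fun i => by
    simpa using hm.prod_factor i
  set r : ι → Hilb ι := fun i => vecOf (fun j => star (m i j)) (hrow i) with hr
  have hrs : ∀ i, ‖r i‖ ^ 2 = ∑' j, ‖m i j‖ ^ 2 := fun i => by
    rw [← (hasSum_coord_sq (r i)).tsum_eq]
    simp [hr, coord_vecOf]
  have hsum : Summable fun i => ‖r i‖ ^ 2 := by
    simp_rw [hrs]
    exact hm.prod
  have hb : ∀ x i, ‖⟪r i, x⟫_ℂ‖ ^ 2 ≤ ‖r i‖ ^ 2 * ‖x‖ ^ 2 := fun x i => by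
    rw [← mul_pow]
    gcongr
    exact norm_inner_le_norm _ _
  have hx : ∀ x : Hilb ι, Summable fun i => ‖⟪r i, x⟫_ℂ‖ ^ 2 := fun x =>
    Summable.of_nonneg_of_le (fun _ => sq_nonneg _) (hb x) (hsum.mul_right _)
  let L : Hilb ι →ₗ[ℂ] Hilb ι :=
    { toFun := fun x => vecOf (fun i => ⟪r i, x⟫_ℂ) (hx x)
      map_add' := fun x y => by
        apply (ket ι).repr.injective
        ext i
        exact inner_add_right _ _ _
      map_smul' := fun c x => by
        apply (ket ι).repr.injective
        ext i
        exact inner_smul_right _ _ _ }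
  have hL : ∀ x, ‖L x‖ ≤ √(∑' i, ‖r i‖ ^ 2) * ‖x‖ := fun x => by
    have h1 : ‖L x‖ ^ 2 ≤ (∑' i, ‖r i‖ ^ 2) * ‖x‖ ^ 2 := by
      rw [← (hasSum_coord_sq (L x)).tsum_eq, ← tsum_mul_right]
      exact Summable.tsum_le_tsum (hb x) (hx x) (hsum.mul_right _)
    calc ‖L x‖ = √(‖L x‖ ^ 2) := (Real.sqrt_sq (norm_nonneg _)).symm
      _ ≤ √((∑' i, ‖r i‖ ^ 2) * ‖x‖ ^ 2) := Real.sqrt_le_sqrt h1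
      _ = _ := by
        rw [Real.sqrt_mul (tsum_nonneg fun _ => sq_nonneg _), Real.sqrt_sq (norm_nonneg x)]
  refine ⟨L.mkContinuous _ hL, fun i j => ?_⟩
  have e1 : entry (L.mkContinuous _ hL) i j = ⟪r i, ket ι j⟫_ℂ := by
    rw [entry, ← coord_eq_inner]
    rfl
  rw [e1, ← inner_conj_symm, ← coord_eq_inner]
  simp [hr, coord_vecOf]

theorem entry_ofMatrix {m : ι → ι → ℂ} (hm : ∃ T : Op ι, ∀ i j, entry T i j = m i j) (i j : ι) :
    entry (ofMatrix m) i j = m i j := by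
  rw [ofMatrix, dif_pos hm]
  exact hm.choose_spec i j

/-- Trace-class operators are Hilbert--Schmidt. -/
theorem summable_entry_sq {T : Op ι} (hT : T ∈ TraceClass ι) :
    Summable fun p : ι × ι => ‖entry T p.1 p.2‖ ^ 2 := by
  have h1 : ∑' j, ∑' i, ENNReal.ofReal (‖entry T i j‖ ^ 2)
      ≤ ENNReal.ofReal (‖sqrtAbs T‖ ^ 2) * traceNorm T := by
    rw [traceNorm, ← ENNReal.tsum_mul_left]
    refine ENNReal.tsum_le_tsum fun j => ?_
    have e : ∑' i, ENNReal.ofReal (‖entry T i j‖ ^ 2) = ENNReal.ofReal (‖T (ket ι j)‖ ^ 2) :=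
      tsum_inner_sq (ket ι) (T (ket ι j))
    have e2 : (entry (absOp T) j j).re = ‖sqrtAbs T (ket ι j)‖ ^ 2 := re_inner_abs T (ket ι j)
    rw [e, e2, ← ENNReal.ofReal_mul (sq_nonneg _), ← norm_abs_apply, ← mul_pow]
    refine ENNReal.ofReal_le_ofReal ?_
    have e3 : absOp T (ket ι j) = sqrtAbs T (sqrtAbs T (ket ι j)) :=
      congrArg (fun S : Op ι => S (ket ι j)) (sqrtAbs_mul_sqrtAbs T).symm
    rw [e3]
    gcongr
    exact ContinuousLinearMap.le_opNorm _ _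
  have h2 : ∑' p : ι × ι, ENNReal.ofReal (‖entry T p.1 p.2‖ ^ 2) ≠ ⊤ := by
    rw [ENNReal.tsum_prod (f := fun i j => ENNReal.ofReal (‖entry T i j‖ ^ 2)),
      ENNReal.tsum_comm]
    exact (h1.trans_lt (ENNReal.mul_lt_top ENNReal.ofReal_lt_top hT)).ne
  have h3 := ENNReal.summable_toReal h2
  simpa [ENNReal.toReal_ofReal] using h3

end Spaces

section Bipartite

variable {α β : Type*}

/-- The product vector `ψ ⊗ φ` in `ℓ²(α) ⊗ ℓ²(β) = ℓ²(α × β)`. -/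
def tensorVec (ψ : Hilb α) (φ : Hilb β) : Hilb (α × β) :=
  vecOf (fun p => coord ψ p.1 * coord φ p.2) (by
    have h := (summable_coord ψ).mul_of_nonneg (summable_coord φ) (fun _ => sq_nonneg _)
      (fun _ => sq_nonneg _)
    simpa only [norm_mul, mul_pow] using h)

/-- The operator `|ψ⟩⟨ψ|`. -/
def proj {ι : Type*} (ψ : Hilb ι) : Op ι := InnerProductSpace.rankOne ℂ ψ ψ

/-- `Y` is the partial transpose (on the second subsystem) of `X`. -/
def IsPartialTranspose (X Y : Op (α × β)) : Prop :=
  ∀ a b a' b', entry Y (a, b) (a', b') = entry X (a, b') (a', b)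

/-- The partial transpose on the second subsystem; it always exists as a bounded operator
for a trace-class `T`. -/
def ptranspose (T : Op (α × β)) : Op (α × β) :=
  ofMatrix fun p q => entry T (p.1, q.2) (q.1, p.2)

/-- The exchange of the two `B` indices of a matrix. -/
def swapEquiv (α β : Type*) : (α × β) × (α × β) ≃ (α × β) × (α × β) where
  toFun p := ((p.1.1, p.2.2), (p.2.1, p.1.2))
  invFun p := ((p.1.1, p.2.2), (p.2.1, p.1.2))
  left_inv _ := rfl
  right_inv _ := rfl

theorem summable_swap {g : (α × β) × (α × β) → ℝ} (hg : Summable g) :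
    Summable fun p : (α × β) × (α × β) => g ((p.1.1, p.2.2), (p.2.1, p.1.2)) :=
  (swapEquiv α β).summable_iff.2 hg

/-- The regrouping of the indices of `n` copies. -/
def copiesEquiv (α β : Type*) (n : ℕ) :
    ((Fin n → α) × (Fin n → β)) × ((Fin n → α) × (Fin n → β)) ≃
      (Fin n → (α × β) × (α × β)) where
  toFun r k := ((r.1.1 k, r.1.2 k), (r.2.1 k, r.2.2 k))
  invFun f := ((fun k => (f k).1.1, fun k => (f k).1.2),
    (fun k => (f k).2.1, fun k => (f k).2.2))
  left_inv _ := rfl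
  right_inv _ := rfl

theorem summable_pi {γ : Type*} {g : γ → ℝ} (h0 : ∀ r, 0 ≤ g r) (hg : Summable g) (n : ℕ) :
    Summable fun f : Fin n → γ => ∏ k, g (f k) := by
  classical
  refine summable_of_sum_le (c := ∏ _k : Fin n, ∑' r, g r)
    (fun f => Finset.prod_nonneg fun k _ => h0 _) fun u => ?_
  calc ∑ f ∈ u, ∏ k, g (f k)
      ≤ ∑ f ∈ Fintype.piFinset fun k => u.image fun f => f k, ∏ k, g (f k) := by
        refine Finset.sum_le_sum_of_subset_of_nonneg ?_
          fun f _ _ => Finset.prod_nonneg fun k _ => h0 _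
        intro f hf
        exact Fintype.mem_piFinset.2 fun k => Finset.mem_image_of_mem _ hf
    _ = ∏ k, ∑ r ∈ u.image fun f => f k, g r := (Finset.prod_univ_sum _ _).symm
    _ ≤ _ := Finset.prod_le_prod (fun k _ => Finset.sum_nonneg fun _ _ => h0 _)
        fun k _ => hg.sum_le_tsum _ fun _ _ => h0 _

theorem summable_copies {g : (α × β) × (α × β) → ℝ} (h0 : ∀ r, 0 ≤ g r) (hg : Summable g)
    (n : ℕ) : Summable fun r : ((Fin n → α) × (Fin n → β)) × ((Fin n → α) × (Fin n → β)) =>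
      ∏ k, g ((r.1.1 k, r.1.2 k), (r.2.1 k, r.2.2 k)) := by
  have h := (copiesEquiv α β n).summable_iff.2 (summable_pi h0 hg n)
  simpa only [Function.comp_def, copiesEquiv, Equiv.coe_fn_mk] using h

theorem isPartialTranspose_ptranspose {T : Op (α × β)} (hT : T ∈ TraceClass (α × β)) :
    IsPartialTranspose T (ptranspose T) := by
  intro a b a' b'
  have h := summable_swap (g := fun r => ‖entry T r.1 r.2‖ ^ 2) (summable_entry_sq hT)
  exact entry_ofMatrix (m := fun p q : α × β => entry T (p.1, q.2) (q.1, p.2))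
    (exists_op_of_summable _ h) (a, b) (a', b')

/-- `n` copies of a bipartite operator, as an operator of the bipartite system `Aⁿ : Bⁿ`. -/
def tensorPow (T : Op (α × β)) (n : ℕ) : Op ((Fin n → α) × (Fin n → β)) :=
  ofMatrix fun p q => ∏ k, entry T (p.1 k, p.2 k) (q.1 k, q.2 k)

theorem entry_tensorPow {T : Op (α × β)} (hT : T ∈ TraceClass (α × β)) (n : ℕ)
    (p q : (Fin n → α) × (Fin n → β)) :
    entry (tensorPow T n) p q = ∏ k, entry T (p.1 k, p.2 k) (q.1 k, q.2 k) := by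
  refine entry_ofMatrix (m := fun p q : (Fin n → α) × (Fin n → β) =>
    ∏ k, entry T (p.1 k, p.2 k) (q.1 k, q.2 k)) (exists_op_of_summable _ ?_) p q
  simp only [norm_prod, ← Finset.prod_pow]
  exact summable_copies (g := fun r => ‖entry T r.1 r.2‖ ^ 2) (fun _ => sq_nonneg _)
    (summable_entry_sq hT) n

/-- Separable states: the trace-norm closed convex hull of the pure product states. -/
def sepStates (α β : Type*) : Set (Op (α × β)) :=
  {σ | ∀ ε : ℝ≥0∞, 0 < ε → ∃ τ ∈ convexHull ℝ {P : Op (α × β) |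
    ∃ (ψ : Hilb α) (φ : Hilb β), ‖ψ‖ = 1 ∧ ‖φ‖ = 1 ∧ P = proj (tensorVec ψ φ)},
      traceNorm (σ - τ) < ε}

/-- The two choices of free operators: separable, or with positive partial transpose. -/
inductive Kind
  | sep
  | ppt

/-- The cone of separable operators, respectively of PPT operators. -/
def cone : Kind → (α β : Type*) → Set (Op (α × β))
  | .sep, α, β => {T | ∃ l : ℝ, 0 ≤ l ∧ ∃ σ ∈ sepStates α β, T = (l : ℂ) • σ}
  | .ppt, α, β => {T | T ∈ TraceClass (α × β) ∧ 0 ≤ T ∧ 0 ≤ ptranspose T}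

/-- The standard robustness `R^s_K(ρ) = inf {Tr δ : δ ∈ K, ρ + δ ∈ K}`. -/
def stdRobustness (K : Kind) (ρ : Op (α × β)) : ℝ≥0∞ :=
  ⨅ δ : {δ : Op (α × β) // δ ∈ cone K α β ∧ ρ + δ ∈ cone K α β},
    ENNReal.ofReal (tr (δ : Op (α × β))).re

/-- The negativity `N(ρ) = (‖ρ^Γ‖₁ - 1) / 2`. -/
def negativity (ρ : Op (α × β)) : ℝ≥0∞ := (traceNorm (ptranspose ρ) - 1) / 2

/-- The operator interval `[-1, 1]_{K^*}`. -/
def dualInterval (K : Kind) (α β : Type*) : Set (Op (α × β)) :=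
  {Z | IsSelfAdjoint Z ∧ ∀ W ∈ cone K α β, |(tr (Z * W)).re| ≤ (tr W).re}

/-- The `ω`-tempered `K`-robustness `R^τ_K(ρ|ω)`, defined by
`1 + 2 R^τ_K(ρ|ω) = sup {Tr Xρ : X ∈ [-1, 1]_{K^*}, ‖X‖ = Tr Xω}`. -/
def temperedRobustness (K : Kind) (ρ ω : Op (α × β)) : ℝ≥0∞ :=
  ((⨆ X : {X : Op (α × β) // X ∈ dualInterval K α β ∧ (‖X‖ : ℂ) = tr (X * ω)},
    ENNReal.ofReal (tr ((X : Op (α × β)) * ρ)).re) - 1) / 2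

/-- The `ω`-tempered negativity
`N_τ(ρ|ω) = sup {Tr Xρ : X = X†, ‖X^Γ‖ ≤ 1, ‖X‖ = Tr Xω}`. -/
def temperedNegativity (ρ ω : Op (α × β)) : ℝ≥0∞ :=
  ⨆ X : {X : Op (α × β) // IsSelfAdjoint X ∧ (∃ Y, IsPartialTranspose X Y ∧ ‖Y‖ ≤ 1) ∧
      (‖X‖ : ℂ) = tr (X * ω)},
    ENNReal.ofReal (tr ((X : Op (α × β)) * ρ)).re

/-- The base-two logarithm of an extended non-negative number. -/
def log2 (x : ℝ≥0∞) : EReal := ENNReal.log x / (Real.log 2 : ℝ)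

/-- The tempered logarithmic negativity `E^τ_N(ρ) = log₂ N_τ(ρ|ρ)`. -/
def temperedLogNegativity (ρ : Op (α × β)) : EReal := log2 (temperedNegativity ρ ρ)

/-- `L^τ_K(ρ) = limsup (1/n) log₂ (1 + R^τ_K(ρ^{⊗n}))`. -/
def temperedRobustnessRate (K : Kind) (ρ : Op (α × β)) : EReal :=
  Filter.limsup (fun n : ℕ =>
    log2 (1 + temperedRobustness K (tensorPow ρ n) (tensorPow ρ n)) / (n : EReal)) Filter.atTop

end Bipartite

section Cost

/-- The entanglement bit `Φ₂ = |Φ₂⟩⟨Φ₂|` with `|Φ₂⟩ = (|00⟩ + |11⟩) / √2`. -/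
def ebit : Op (Fin 2 × Fin 2) :=
  proj (((1 / √2 : ℝ) : ℂ) • (ket (Fin 2 × Fin 2) (0, 0) + ket (Fin 2 × Fin 2) (1, 1)))

/-- `k` entanglement bits, as a trace-class operator of the bipartite system `A₀ᵏ : B₀ᵏ`. -/
def ebits (k : ℕ) : TraceClass ((Fin k → Fin 2) × (Fin k → Fin 2)) :=
  ⟨tensorPow ebit k, mem_traceClass_of_finite _⟩

/-- Positive trace-preserving linear maps between spaces of trace-class operators. -/
def IsPTP {ι κ : Type*} (Λ : TraceClass ι →ₗ[ℂ] TraceClass κ) : Prop :=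
  (∀ T : TraceClass ι, 0 ≤ (T : Op ι) → 0 ≤ (Λ T : Op κ)) ∧
    ∀ T : TraceClass ι, tr (Λ T : Op κ) = tr (T : Op ι)

/-- The `(M, δ)`-approximately `K`-preserving maps from `AB` to `A'B'`: the positive
trace-preserving maps `Λ` with `M(Λ(σ)) ≤ δ` for all states `σ` in the cone `K`. -/
def approxPreserving (K : Kind) {α β α' β' : Type*} (M : Op (α' × β') → ℝ≥0∞) (δ : ℝ) :
    Set (TraceClass (α × β) →ₗ[ℂ] TraceClass (α' × β')) :=
  {Λ | IsPTP Λ ∧ ∀ σ : TraceClass (α × β), (σ : Op (α × β)) ∈ cone K α β →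
    IsState (σ : Op (α × β)) → M (Λ σ) ≤ ENNReal.ofReal δ}

/-- The least error `½ ‖Λ(Φ₂^{⊗k}) - ρ‖₁` with which `ρ` can be prepared from `k` entanglement
bits by means of an `(M, δ)`-approximately `K`-preserving map `Λ`. -/
def dilutionError (K : Kind) {α β : Type*} (M : Op (α × β) → ℝ≥0∞) (δ : ℝ) (k : ℕ)
    (ρ : Op (α × β)) : ℝ≥0∞ :=
  ⨅ Λ : {Λ : TraceClass ((Fin k → Fin 2) × (Fin k → Fin 2)) →ₗ[ℂ] TraceClass (α × β) //
      Λ ∈ approxPreserving K M δ},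
    traceNorm ((Λ.1 (ebits k) : Op (α × β)) - ρ) / 2

/-- The entanglement cost of `ρ` at error threshold `ε` under `(M, (δₙ))`-approximately
`K`-preserving maps; `M` is a family of functions, one for each number of copies. -/
def cost (K : Kind) {α β : Type*} (M : ∀ n : ℕ, Op ((Fin n → α) × (Fin n → β)) → ℝ≥0∞)
    (δ : ℕ → ℝ) (ε : ℝ) (ρ : Op (α × β)) : EReal :=
  ⨅ R : {R : ℝ // 0 < R ∧ Filter.limsup (fun n : ℕ =>
      dilutionError K (M n) (δ n) ⌊R * n⌋₊ (tensorPow ρ n)) Filter.atTop ≤ ENNReal.ofReal ε},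
    ((R : ℝ) : EReal)

/-- The cost when the generated entanglement is measured by the standard robustness `R^s_K`. -/
def costRobustness (K : Kind) {α β : Type*} (δ : ℕ → ℝ) (ε : ℝ) (ρ : Op (α × β)) : EReal :=
  cost K (fun _ => stdRobustness K) δ ε ρ

/-- The cost when the generated entanglement is measured by the negativity. -/
def costNegativity (K : Kind) {α β : Type*} (δ : ℕ → ℝ) (ε : ℝ) (ρ : Op (α × β)) : EReal :=
  cost K (fun _ => negativity) δ ε ρ

end Cost

end Ent

end

/-!
Every bound comes from evaluating a witness, a bounded self-adjoint operator `X`, on the target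
state. A witness of the tempered quantities satisfies `‖X‖ = Tr X ρ^{⊗n}`, so an error `ε` in trace
distance lowers its value by at most `2 ε ‖X‖`. For `ε < 1/2` a constant fraction of `‖X‖` survives
(`one_sub_mul_norm_le`).

On the output of an approximately `K`-preserving map, `X` is at most `1 + 2 δₙ` on the image of each
free state: from the decomposition defining the standard robustness if `X ∈ [-1, 1]_{K^*}`, and from
the duality of the trace and operator norms if `‖X^Γ‖ ≤ 1`. The maximally entangled state of local
dimension `d = 2ᵏ` has the form `d E + D - d M` with separable states `E`, `D`, `M`
(`exists_separable_decomposition`), hence `X` is at most `(2 d + 1)(1 + 2 δₙ)` on the image of `k`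
entanglement bits. The number `δₙ` is subexponential, so at an achievable rate `R` the norms `‖X‖`
grow at most like `2^{Rn}` (`exists_eventually_norm_le`, `limsup_log2_div_le`).

The witnesses of the tempered negativity tensorize: if `‖X^Γ‖ ≤ 1` and `‖X‖ = Tr X ρ`, then
`X^{⊗n}` has the same properties with respect to `ρ^{⊗n}` and its norm is `‖X‖ⁿ`
(`norm_tensorPow_eq`). It lies in `[-1, 1]_{K^*}`, because free operators are PPT
(`cone_subset_ppt`) and `Tr X W = Tr X^Γ W^Γ` (`tr_mul_eq_of_isPartialTranspose`). This compares the
tempered negativity with the tempered robustness rate, and reduces the bound on the cost under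
negativity constraints to the same growth estimate.

In infinite dimension the pairing `Tr X W` of a bounded with a trace-class operator is not an
absolutely convergent double series of matrix elements. The invariance under partial transposition
is obtained from finite blocks, on which it is a reindexing; the blocks converge by
`tendsto_sum_entry`. The tensor powers of bounded operators are constructed from `X ⊗ 1`, which acts
on the slices of a vector of `ℓ²(γ × κ)`.
-/

namespace Ent

/-! ### The trace pairing of bounded and trace-class operators -/

section Pairing

variable {ι : Type*}

theorem entry_add (S T : Op ι) (i j : ι) : entry (S + T) i j = entry S i j + entry T i j :=
  inner_add_right _ _ _

theorem entry_sub (S T : Op ι) (i j : ι) : entry (S - T) i j = entry S i j - entry T i j :=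
  inner_sub_right _ _ _

theorem entry_smul (c : ℂ) (T : Op ι) (i j : ι) : entry (c • T) i j = c * entry T i j :=
  inner_smul_right _ _ _

theorem entry_star (T : Op ι) (i j : ι) : entry (star T) i j = star (entry T j i) := by
  rw [entry, entry, ContinuousLinearMap.star_eq_adjoint, ContinuousLinearMap.adjoint_inner_right]
  exact (inner_conj_symm _ _).symm

theorem hasSum_entry_mul (S T : Op ι) (i j : ι) :
    HasSum (fun r => entry S i r * entry T r j) (entry (S * T) i j) := by
  have h := (ket ι).hasSum_inner_mul_inner (star S (ket ι i)) (T (ket ι j))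
  simp only [ContinuousLinearMap.star_eq_adjoint, ContinuousLinearMap.adjoint_inner_left] at h
  exact h

/-- Hölder's inequality for the trace pairing, `∑ᵢ |⟨i|X T|i⟩| ≤ ‖X‖ ‖T‖₁`. -/
theorem tsum_entry_mul_le (X T : Op ι) :
    ∑' i, ENNReal.ofReal ‖entry (X * T) i i‖ ≤ ENNReal.ofReal ‖X‖ * traceNorm T := by
  rcases eq_or_ne X 0 with rfl | hX
  · simp [entry]
  have hX' : 0 < ‖X‖ := norm_pos_iff.2 hX
  rw [ENNReal.tsum_eq_iSup_sum]
  refine iSup_le fun F => ?_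
  have h := sum_inner_le (ket ι) T (((‖X‖⁻¹ : ℝ) : ℂ) • star X) (fun x => by
    have h1 : ‖star X x‖ ≤ ‖X‖ * ‖x‖ := by
      simpa [norm_star] using (star X).le_opNorm x
    rw [smul_apply, norm_smul, Complex.norm_real, norm_inv, norm_norm,
      inv_mul_le_iff₀ hX']
    exact h1) F
  calc _ = ENNReal.ofReal ‖X‖ * ∑ i ∈ F, ENNReal.ofReal
        ‖⟪(((‖X‖⁻¹ : ℝ) : ℂ) • star X) (ket ι i), T (ket ι i)⟫_ℂ‖ := by
        rw [Finset.mul_sum]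
        refine Finset.sum_congr rfl fun i _ => ?_
        rw [← ENNReal.ofReal_mul hX'.le, smul_apply, inner_smul_left,
          norm_mul, Complex.conj_ofReal, Complex.norm_real, norm_inv, norm_norm,
          mul_inv_cancel_left₀ hX'.ne', ContinuousLinearMap.star_eq_adjoint,
          ContinuousLinearMap.adjoint_inner_left]
        rfl
    _ ≤ _ := by gcongr; exact h

theorem summable_norm_entry_mul (X : Op ι) {T : Op ι} (hT : T ∈ TraceClass ι) :
    Summable fun i => ‖entry (X * T) i i‖ := by
  have h := ENNReal.summable_toReal ((tsum_entry_mul_le X T).trans_lt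
    (ENNReal.mul_lt_top ENNReal.ofReal_lt_top hT)).ne
  simpa [ENNReal.toReal_ofReal] using h

theorem summable_entry_mul (X : Op ι) {T : Op ι} (hT : T ∈ TraceClass ι) :
    Summable fun i => entry (X * T) i i :=
  (summable_norm_entry_mul X hT).of_norm

theorem norm_tr_mul_le (X : Op ι) {T : Op ι} (hT : T ∈ TraceClass ι) :
    ‖tr (X * T)‖ ≤ ‖X‖ * (traceNorm T).toReal := by
  have hs := summable_norm_entry_mul X hT
  refine (norm_tsum_le_tsum_norm hs).trans ?_
  have h := tsum_entry_mul_le X T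
  rw [← ENNReal.ofReal_tsum_of_nonneg (fun _ => norm_nonneg _) hs,
    ← ENNReal.ofReal_toReal (show traceNorm T ≠ ⊤ from ne_of_lt hT),
    ← ENNReal.ofReal_mul (norm_nonneg _)] at h
  exact (ENNReal.ofReal_le_ofReal_iff (by positivity)).1 h

theorem summable_entry_diag {T : Op ι} (hT : T ∈ TraceClass ι) :
    Summable fun i => entry T i i := by
  simpa using summable_entry_mul 1 hT

theorem tr_mul_add (X : Op ι) {S T : Op ι} (hS : S ∈ TraceClass ι) (hT : T ∈ TraceClass ι) :
    tr (X * (S + T)) = tr (X * S) + tr (X * T) := by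
  simp only [tr, mul_add, entry_add]
  exact (summable_entry_mul X hS).tsum_add (summable_entry_mul X hT)

theorem tr_mul_sub (X : Op ι) {S T : Op ι} (hS : S ∈ TraceClass ι) (hT : T ∈ TraceClass ι) :
    tr (X * (S - T)) = tr (X * S) - tr (X * T) := by
  simp only [tr, mul_sub, entry_sub]
  exact (summable_entry_mul X hS).tsum_sub (summable_entry_mul X hT)

theorem tr_smul (c : ℂ) (T : Op ι) : tr (c • T) = c * tr T := by
  simp only [tr, entry_smul, tsum_mul_left]

theorem tr_mul_smul (X : Op ι) (c : ℂ) (T : Op ι) : tr (X * (c • T)) = c * tr (X * T) := by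
  rw [mul_smul_comm, tr_smul]

theorem tr_add {S T : Op ι} (hS : S ∈ TraceClass ι) (hT : T ∈ TraceClass ι) :
    tr (S + T) = tr S + tr T := by
  simpa using tr_mul_add 1 hS hT

/-- A matrix element is dominated by the trace norm: it is the pairing with a rank-one operator. -/
theorem norm_inner_apply_le {T : Op ι} (hT : T ∈ TraceClass ι) (x y : Hilb ι) :
    ‖⟪x, T y⟫_ℂ‖ ≤ ‖x‖ * ‖y‖ * (traceNorm T).toReal := by
  have h1 : tr (InnerProductSpace.rankOne ℂ y x * T) = ⟪x, T y⟫_ℂ := by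
    have h := (ket ι).hasSum_inner_mul_inner (star T x) y
    rw [ContinuousLinearMap.star_eq_adjoint, ContinuousLinearMap.adjoint_inner_left] at h
    rw [← h.tsum_eq]
    refine tsum_congr fun i => ?_
    simp [entry, ContinuousLinearMap.adjoint_inner_left]
  rw [← h1]
  refine (norm_tr_mul_le _ hT).trans ?_
  gcongr
  rw [InnerProductSpace.norm_rankOne, mul_comm]

theorem norm_entry_le {T : Op ι} (hT : T ∈ TraceClass ι) (i j : ι) :
    ‖entry T i j‖ ≤ (traceNorm T).toReal := by
  have h := norm_inner_apply_le hT (ket ι i) (ket ι j)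
  rwa [(ket ι).orthonormal.1, (ket ι).orthonormal.1, one_mul, one_mul] at h

end Pairing

/-! ### Positive operators -/

section Positive

variable {ι : Type*}

open scoped ComplexOrder

/-- The value of the quadratic form of `T` at the finitely supported vector `∑_{i ∈ F} c i |i⟩`. -/
noncomputable def quadForm (T : Op ι) (F : Finset ι) (c : ι → ℂ) : ℂ :=
  ∑ i ∈ F, ∑ j ∈ F, star (c i) * entry T i j * c j

theorem quadForm_eq_inner (T : Op ι) (F : Finset ι) (c : ι → ℂ) :
    quadForm T F c = ⟪∑ i ∈ F, c i • ket ι i, T (∑ i ∈ F, c i • ket ι i)⟫_ℂ := by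
  simp only [quadForm, map_sum, map_smul, sum_inner, inner_sum, inner_smul_left,
    inner_smul_right, entry]
  rw [Finset.sum_comm]
  refine Finset.sum_congr rfl fun i _ => ?_
  rw [Finset.mul_sum]
  refine Finset.sum_congr rfl fun j _ => ?_
  simp only [starRingEnd_apply]
  ring

theorem inner_apply_nonneg {T : Op ι} (hT : 0 ≤ T) (x : Hilb ι) : 0 ≤ ⟪x, T x⟫_ℂ :=
  ((ContinuousLinearMap.nonneg_iff_isPositive T).1 hT).inner_nonneg_right x

theorem tendsto_truncation (x : Hilb ι) :
    Filter.Tendsto (fun F : Finset ι => ∑ i ∈ F, coord x i • ket ι i) Filter.atTop (nhds x) :=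
  (ket ι).hasSum_repr x

theorem nonneg_iff_quadForm {T : Op ι} : 0 ≤ T ↔ ∀ F c, 0 ≤ quadForm T F c := by
  refine ⟨fun h F c => ?_, fun h => ?_⟩
  · rw [quadForm_eq_inner]
    exact inner_apply_nonneg h _
  · have key : ∀ x : Hilb ι, 0 ≤ ⟪x, T x⟫_ℂ := fun x => by
      have hx := tendsto_truncation x
      have h1 := hx.inner (𝕜 := ℂ) ((T.continuous.tendsto x).comp hx)
      refine ge_of_tendsto' h1 fun F => ?_
      have := h F (coord x)
      rwa [quadForm_eq_inner] at this
    rw [ContinuousLinearMap.nonneg_iff_isPositive, ContinuousLinearMap.isPositive_iff_complex]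
    intro x
    have h2 := key x
    rw [← inner_conj_symm] at h2
    obtain ⟨h3, h4⟩ := Complex.le_def.1 h2
    simp only [Complex.zero_re, Complex.conj_re, Complex.zero_im, Complex.conj_im] at h3 h4
    refine ⟨Complex.ext (by simp) ?_, h3⟩
    simp only [RCLike.re_to_complex, Complex.ofReal_im]
    linarith

/-- Positivity passes to limits of the matrix elements. -/
theorem nonneg_of_tendsto_entry {T : Op ι} {S : ℕ → Op ι} (hS : ∀ n, 0 ≤ S n)
    (h : ∀ i j, Filter.Tendsto (fun n => entry (S n) i j) Filter.atTop (nhds (entry T i j))) :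
    0 ≤ T := by
  refine nonneg_iff_quadForm.2 fun F c => ?_
  have hlim : Filter.Tendsto (fun n => quadForm (S n) F c) Filter.atTop
      (nhds (quadForm T F c)) := tendsto_finsetSum _ fun i _ => tendsto_finsetSum _ fun j _ =>
    ((h i j).const_mul _).mul_const _
  exact ge_of_tendsto' hlim fun n => nonneg_iff_quadForm.1 (hS n) F c

theorem entry_diag_nonneg {T : Op ι} (hT : 0 ≤ T) (i : ι) : 0 ≤ entry T i i :=
  inner_apply_nonneg hT _

theorem absOp_of_nonneg {T : Op ι} (hT : 0 ≤ T) : absOp T = T :=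
  CFC.abs_of_nonneg T hT

theorem traceNorm_of_nonneg {T : Op ι} (hT : 0 ≤ T) :
    traceNorm T = ∑' i, ENNReal.ofReal (entry T i i).re := by
  rw [traceNorm, absOp_of_nonneg hT]

theorem mem_traceClass_of_nonneg {T : Op ι} (hT : 0 ≤ T) (h : Summable fun i => entry T i i) :
    T ∈ TraceClass ι := by
  change traceNorm T < ⊤
  rw [traceNorm_of_nonneg hT, ← ENNReal.ofReal_tsum_of_nonneg
    (fun i => (Complex.le_def.1 (entry_diag_nonneg hT i)).1)
    (Complex.hasSum_re h.hasSum).summable]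
  exact ENNReal.ofReal_lt_top

theorem traceNorm_eq_tr {T : Op ι} (hT : 0 ≤ T) (h : T ∈ TraceClass ι) :
    (traceNorm T).toReal = (tr T).re := by
  have hs := Complex.hasSum_re (summable_entry_diag h).hasSum
  have h0 := fun i => (Complex.le_def.1 (entry_diag_nonneg hT i)).1
  rw [traceNorm_of_nonneg hT, ← ENNReal.ofReal_tsum_of_nonneg h0 hs.summable, hs.tsum_eq,
    ENNReal.toReal_ofReal]
  · rfl
  · rw [← hs.tsum_eq]
    exact tsum_nonneg h0

theorem tr_re_nonneg {T : Op ι} (hT : 0 ≤ T) (h : T ∈ TraceClass ι) : 0 ≤ (tr T).re := by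
  rw [← traceNorm_eq_tr hT h]
  exact ENNReal.toReal_nonneg

theorem IsState.traceNorm_toReal {ρ : Op ι} (h : IsState ρ) : (traceNorm ρ).toReal = 1 := by
  rw [traceNorm_eq_tr h.1 h.2.1, h.2.2, Complex.one_re]

theorem proj_nonneg (ψ : Hilb ι) : 0 ≤ proj ψ :=
  (ContinuousLinearMap.nonneg_iff_isPositive _).2 (InnerProductSpace.isPositive_rankOne_self ψ)

theorem entry_proj (ψ : Hilb ι) (i j : ι) : entry (proj ψ) i j = coord ψ i * star (coord ψ j) := by
  have h : ⟪ψ, ket ι j⟫_ℂ = star (coord ψ j) := by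
    rw [coord_eq_inner]
    exact (inner_conj_symm _ _).symm
  rw [entry, proj, InnerProductSpace.rankOne_apply, inner_smul_right, ← coord_eq_inner, h, mul_comm]

theorem hasSum_entry_proj (ψ : Hilb ι) :
    HasSum (fun i => entry (proj ψ) i i) ((‖ψ‖ ^ 2 : ℝ) : ℂ) := by
  have h := Complex.hasSum_ofReal.2 (hasSum_coord_sq ψ)
  refine h.congr_fun fun i => ?_
  rw [entry_proj, Complex.star_def, Complex.mul_conj']
  norm_cast

theorem proj_mem_traceClass (ψ : Hilb ι) : proj ψ ∈ TraceClass ι :=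
  mem_traceClass_of_nonneg (proj_nonneg ψ) (hasSum_entry_proj ψ).summable

/-- A self-adjoint trace-class operator is a difference of positive trace-class operators. -/
theorem exists_posPart_negPart {T : Op ι} (hT : T ∈ TraceClass ι) (hs : IsSelfAdjoint T) :
    ∃ P N : Op ι, 0 ≤ P ∧ 0 ≤ N ∧ P ∈ TraceClass ι ∧ N ∈ TraceClass ι ∧ T = P - N := by
  have hadd : T⁺ + T⁻ = absOp T := CFC.posPart_add_negPart T hs
  have hP : 0 ≤ T⁺ := CFC.posPart_nonneg T
  have hN : 0 ≤ T⁻ := CFC.negPart_nonneg T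
  have key : traceNorm T⁺ + traceNorm T⁻ = traceNorm T := by
    rw [traceNorm_of_nonneg hP, traceNorm_of_nonneg hN, ← ENNReal.tsum_add, traceNorm, ← hadd]
    refine tsum_congr fun i => ?_
    rw [entry_add, Complex.add_re, ENNReal.ofReal_add
      (Complex.le_def.1 (entry_diag_nonneg hP i)).1 (Complex.le_def.1 (entry_diag_nonneg hN i)).1]
  have hfin : traceNorm T⁺ + traceNorm T⁻ < ⊤ := key ▸ hT
  exact ⟨T⁺, T⁻, hP, hN, (ENNReal.add_lt_top.1 hfin).1, (ENNReal.add_lt_top.1 hfin).2,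
    (CFC.posPart_sub_negPart T hs).symm⟩

end Positive

/-! ### The trace pairing and partial transposition -/

section Truncation

variable {ι : Type*}

theorem norm_truncation_le (x : Hilb ι) (F : Finset ι) :
    ‖∑ i ∈ F, coord x i • ket ι i‖ ≤ ‖x‖ := by
  have h : ‖∑ i ∈ F, coord x i • ket ι i‖ ^ 2 = ∑ i ∈ F, ‖coord x i‖ ^ 2 := by
    have h1 := (ket ι).orthonormal.inner_sum (coord x) (coord x) F
    rw [inner_self_eq_norm_sq_to_K] at h1
    simp only [Complex.conj_mul'] at h1
    apply Complex.ofReal_injective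
    push_cast
    exact h1
  refine (sq_le_sq₀ (norm_nonneg _) (norm_nonneg _)).1 ?_
  rw [h]
  exact sum_le_hasSum F (fun _ _ => sq_nonneg _) (hasSum_coord_sq x)

theorem tendsto_quadForm (X : Op ι) (x : Hilb ι) :
    Filter.Tendsto (fun F => quadForm X F (coord x)) Filter.atTop (nhds ⟪x, X x⟫_ℂ) := by
  have hx := tendsto_truncation x
  have h := hx.inner (𝕜 := ℂ) ((X.continuous.tendsto x).comp hx)
  simp only [quadForm_eq_inner]
  exact h

theorem norm_quadForm_le (X : Op ι) (x : Hilb ι) (F : Finset ι) :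
    ‖quadForm X F (coord x)‖ ≤ ‖X‖ * ‖x‖ ^ 2 := by
  rw [quadForm_eq_inner]
  have h := norm_truncation_le x F
  calc _ ≤ ‖∑ i ∈ F, coord x i • ket ι i‖ * (‖X‖ * ‖∑ i ∈ F, coord x i • ket ι i‖) :=
        (norm_inner_le_norm _ _).trans (by gcongr; exact X.le_opNorm _)
    _ ≤ ‖x‖ * (‖X‖ * ‖x‖) := by gcongr
    _ = _ := by ring

/-- An operator `B` with `∑ⱼ ‖B|j⟩‖² < ∞` has square-summable matrix elements. -/
theorem summable_entry_sq_of_summable {B : Op ι} (h : Summable fun j => ‖B (ket ι j)‖ ^ 2) :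
    Summable fun r : ι × ι => ‖entry B r.2 r.1‖ ^ 2 := by
  have hcol : ∀ j, HasSum (fun p => ‖entry B p j‖ ^ 2) (‖B (ket ι j)‖ ^ 2) := fun j => by
    have h1 := hasSum_coord_sq (B (ket ι j))
    simp only [coord_eq_inner] at h1
    exact h1
  refine (summable_prod_of_nonneg fun _ => sq_nonneg _).2 ⟨fun j => (hcol j).summable, ?_⟩
  simpa only [(hcol _).tsum_eq] using h

theorem entry_star_mul (S Y : Op ι) (i j : ι) :
    entry (star S * Y) i j = ⟪S (ket ι i), Y (ket ι j)⟫_ℂ :=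
  ContinuousLinearMap.adjoint_inner_right S (ket ι i) (Y (ket ι j))

/-- Cyclicity of the trace in the form `Tr X S² = ∑ⱼ ⟨S j|X|S j⟩`, for a self-adjoint
Hilbert--Schmidt operator `S`. -/
theorem tsum_inner_eq_tr (X : Op ι) {S : Op ι} (hS : star S = S)
    (h : Summable fun j => ‖S (ket ι j)‖ ^ 2) :
    ∑' j, ⟪S (ket ι j), X (S (ket ι j))⟫_ℂ = tr (X * (S * S)) := by
  have hXS : Summable fun j => ‖(X * S) (ket ι j)‖ ^ 2 := by
    refine Summable.of_nonneg_of_le (fun _ => sq_nonneg _) (fun j => ?_) (h.mul_left (‖X‖ ^ 2))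
    rw [← mul_pow]
    exact pow_le_pow_left₀ (norm_nonneg _) (X.le_opNorm _) 2
  have hf : Summable fun r : ι × ι => entry (X * S) r.2 r.1 * entry S r.1 r.2 := by
    refine Summable.of_norm_bounded
      ((summable_entry_sq_of_summable hXS).add (summable_entry_sq_of_summable h)) fun r => ?_
    have e : ‖entry S r.1 r.2‖ = ‖entry S r.2 r.1‖ := by
      rw [← norm_star (entry S r.2 r.1), ← entry_star, hS]
    rw [norm_mul, e]
    have h1 := two_mul_le_add_sq ‖entry (X * S) r.2 r.1‖ ‖entry S r.2 r.1‖
    have h2 := mul_nonneg (norm_nonneg (entry (X * S) r.2 r.1)) (norm_nonneg (entry S r.2 r.1))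
    linarith
  have h1 : ∀ j, ⟪S (ket ι j), X (S (ket ι j))⟫_ℂ
      = ∑' p, entry (X * S) p j * entry S j p := fun j => by
    have e := entry_star_mul S (X * S) j j
    rw [hS, ← (hasSum_entry_mul S (X * S) j j).tsum_eq] at e
    refine e.symm.trans (tsum_congr fun p => mul_comm _ _)
  have h2 : ∀ p, entry (X * (S * S)) p p = ∑' j, entry (X * S) p j * entry S j p := fun p => by
    rw [← mul_assoc]
    exact (hasSum_entry_mul (X * S) S p p).tsum_eq.symm
  rw [tr, tsum_congr h1, tsum_congr h2]
  exact (Summable.tsum_comm (f := fun j p => entry (X * S) p j * entry S j p) hf).symm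

/-- With `S = √T`, the block sum over `F` is `∑ⱼ ⟨S j|P_F X P_F|S j⟩`, where `P_F` projects onto the
span of the basis vectors in `F`. Dominated convergence applies, with the bounds `‖X‖ ‖S|j⟩‖²`. -/
theorem tendsto_sum_entry_of_nonneg (X : Op ι) {T : Op ι} (h0 : 0 ≤ T) (hT : T ∈ TraceClass ι) :
    Filter.Tendsto (fun F : Finset ι => ∑ p ∈ F, ∑ q ∈ F, entry X p q * entry T q p)
      Filter.atTop (nhds (tr (X * T))) := by
  set S := CFC.sqrt T with hSd
  have hSS : S * S = T := CFC.sqrt_mul_sqrt_self T h0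
  have hS : star S = S := (CFC.sqrt_nonneg T).isSelfAdjoint
  have hS' : ∀ i j, star (entry S i j) = entry S j i := fun i j => by
    rw [← entry_star, hS]
  have hsq : Summable fun j => ‖S (ket ι j)‖ ^ 2 := by
    have h1 := (Complex.hasSum_re (summable_entry_diag hT).hasSum).summable
    refine h1.congr fun j => ?_
    rw [S.apply_norm_sq_eq_inner_adjoint_right, ← ContinuousLinearMap.star_eq_adjoint, hS,
      ← ContinuousLinearMap.mul_def, hSS]
    rfl
  have hfin : ∀ F : Finset ι, ∑ p ∈ F, ∑ q ∈ F, entry X p q * entry T q p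
      = ∑' j, quadForm X F (coord (S (ket ι j))) := fun F => by
    refine (HasSum.tsum_eq ?_).symm
    refine hasSum_sum fun p _ => hasSum_sum fun q _ => ?_
    have h1 := (hasSum_entry_mul S S q p).mul_left (entry X p q)
    rw [hSS] at h1
    refine h1.congr_fun fun j => ?_
    simp only [coord_eq_inner]
    change star (entry S p j) * entry X p q * entry S q j = _
    rw [hS']
    ring
  simp_rw [hfin]
  rw [← hSS, ← tsum_inner_eq_tr X hS hsq]
  exact tendsto_tsum_of_dominated_convergence (hsq.mul_left ‖X‖)
    (fun j => tendsto_quadForm X _) (Filter.Eventually.of_forall fun F j => norm_quadForm_le X _ F)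

/-- The trace pairing is the limit of its restrictions to finite blocks; the double series of
matrix elements itself need not converge absolutely. -/
theorem tendsto_sum_entry (X : Op ι) {T : Op ι} (hs : IsSelfAdjoint T) (hT : T ∈ TraceClass ι) :
    Filter.Tendsto (fun F : Finset ι => ∑ p ∈ F, ∑ q ∈ F, entry X p q * entry T q p)
      Filter.atTop (nhds (tr (X * T))) := by
  obtain ⟨P, N, hP, hN, hPt, hNt, rfl⟩ := exists_posPart_negPart hT hs
  rw [tr_mul_sub X hPt hNt]
  simp only [entry_sub, mul_sub, Finset.sum_sub_distrib]
  exact (tendsto_sum_entry_of_nonneg X hP hPt).sub (tendsto_sum_entry_of_nonneg X hN hNt)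

end Truncation

section PartialTranspose

variable {α β : Type*}

theorem IsPartialTranspose.isSelfAdjoint {T S : Op (α × β)} (h : IsPartialTranspose T S)
    (hT : IsSelfAdjoint T) : IsSelfAdjoint S := by
  refine ext_entry fun p q => ?_
  rw [entry_star, h q.1 q.2 p.1 p.2, h p.1 p.2 q.1 q.2, ← entry_star, hT.star_eq]

/-- The partial transpose preserves the trace pairing. -/
theorem tr_mul_eq_of_isPartialTranspose {X Y T S : Op (α × β)} (hXY : IsPartialTranspose X Y)
    (hTS : IsPartialTranspose T S) (hs : IsSelfAdjoint T) (hT : T ∈ TraceClass (α × β))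
    (hS : S ∈ TraceClass (α × β)) : tr (X * T) = tr (Y * S) := by
  classical
  -- Rectangular blocks are invariant under the exchange of the two `B` indices.
  have hF : Filter.Tendsto (fun F : Finset α × Finset β => F.1 ×ˢ F.2) Filter.atTop
      Filter.atTop := by
    refine Filter.tendsto_atTop_finset_of_monotone
      (fun F G h => Finset.product_subset_product h.1 h.2) fun x => ⟨({x.1}, {x.2}), ?_⟩
    simp
  have h1 := (tendsto_sum_entry X hs hT).comp hF
  have h2 := (tendsto_sum_entry Y (hTS.isSelfAdjoint hs) hS).comp hF
  refine tendsto_nhds_unique h1 (h2.congr fun F => ?_)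
  simp only [Function.comp_apply, Finset.sum_product]
  refine Finset.sum_congr rfl fun a _ => ?_
  have e : ∀ b, ∑ a' ∈ F.1, ∑ b' ∈ F.2, entry Y (a, b) (a', b') * entry S (a', b') (a, b)
      = ∑ b' ∈ F.2, ∑ a' ∈ F.1, entry X (a, b') (a', b) * entry T (a', b) (a, b') := fun b => by
    rw [Finset.sum_comm]
    refine Finset.sum_congr rfl fun b' _ => Finset.sum_congr rfl fun a' _ => ?_
    rw [hXY, hTS]
  simp_rw [e]
  rw [Finset.sum_comm]
  exact Finset.sum_congr rfl fun b _ => Finset.sum_comm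

theorem IsPartialTranspose.eq {T S S' : Op (α × β)} (h : IsPartialTranspose T S)
    (h' : IsPartialTranspose T S') : S = S' :=
  ext_entry fun p q => (h p.1 p.2 q.1 q.2).trans (h' p.1 p.2 q.1 q.2).symm

theorem IsPartialTranspose.ptranspose_eq {T S : Op (α × β)} (h : IsPartialTranspose T S)
    (hT : T ∈ TraceClass (α × β)) : ptranspose T = S :=
  (isPartialTranspose_ptranspose hT).eq h

theorem ptranspose_smul_add_smul {S T : Op (α × β)} (hS : S ∈ TraceClass (α × β))
    (hT : T ∈ TraceClass (α × β)) (a b : ℂ) :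
    ptranspose (a • S + b • T) = a • ptranspose S + b • ptranspose T := by
  refine IsPartialTranspose.ptranspose_eq (fun i j k l => ?_)
    (add_mem (Submodule.smul_mem _ a hS) (Submodule.smul_mem _ b hT))
  simp only [entry_add, entry_smul]
  rw [isPartialTranspose_ptranspose hS, isPartialTranspose_ptranspose hT]

theorem entry_ptranspose_diag {T : Op (α × β)} (hT : T ∈ TraceClass (α × β)) :
    (fun p => entry (ptranspose T) p p) = fun p => entry T p p :=
  funext fun p => isPartialTranspose_ptranspose hT p.1 p.2 p.1 p.2

/-- For a PPT operator `W` and an operator `X` with `‖X^Γ‖ ≤ 1`, one has `|Tr X W| ≤ Tr W`. -/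
theorem abs_tr_mul_le_of_mem_ppt {X Y W : Op (α × β)} (hXY : IsPartialTranspose X Y)
    (hY : ‖Y‖ ≤ 1) (hW : W ∈ cone .ppt α β) : |(tr (X * W)).re| ≤ (tr W).re := by
  obtain ⟨hT, h0, hΓ⟩ := hW
  have hd := entry_ptranspose_diag hT
  have hS : ptranspose W ∈ TraceClass (α × β) :=
    mem_traceClass_of_nonneg hΓ (hd ▸ summable_entry_diag hT)
  rw [tr_mul_eq_of_isPartialTranspose hXY (isPartialTranspose_ptranspose hT)
    h0.isSelfAdjoint hT hS]
  refine (Complex.abs_re_le_norm _).trans ((norm_tr_mul_le Y hS).trans ?_)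
  have htr : tr (ptranspose W) = tr W := by rw [tr, hd, tr]
  rw [traceNorm_eq_tr hΓ hS, htr]
  exact mul_le_of_le_one_left (tr_re_nonneg h0 hT) hY

end PartialTranspose

/-! ### Tensor powers of bounded operators -/

section TensorPower

variable {γ κ : Type*}

theorem hilb_ext {x y : Hilb γ} (h : ∀ i, coord x i = coord y i) : x = y :=
  (ket γ).repr.injective (Subtype.ext (funext h))

theorem coord_add (x y : Hilb γ) (i : γ) : coord (x + y) i = coord x i + coord y i := rfl

theorem coord_smul (c : ℂ) (x : Hilb γ) (i : γ) : coord (c • x) i = c * coord x i := rfl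

theorem coord_ket [DecidableEq γ] (i j : γ) : coord (ket γ j) i = if i = j then 1 else 0 := by
  rw [coord_eq_inner]
  exact orthonormal_iff_ite.1 (ket γ).orthonormal i j

/-- The vectors `(⟨·, k|x⟩)ₖ` of `ℓ²(γ)` that make up a vector `x` of `ℓ²(γ × κ)`. -/
noncomputable def slice (x : Hilb (γ × κ)) (k : κ) : Hilb γ :=
  vecOf (fun g => coord x (g, k)) ((summable_coord x).comp_injective
    fun _ _ h => congrArg Prod.fst h)

theorem coord_slice (x : Hilb (γ × κ)) (k : κ) (g : γ) : coord (slice x k) g = coord x (g, k) :=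
  rfl

theorem hasSum_norm_slice_sq (x : Hilb (γ × κ)) : HasSum (fun k => ‖slice x k‖ ^ 2) (‖x‖ ^ 2) :=
  ((Equiv.prodComm κ γ).hasSum_iff.2 (hasSum_coord_sq x)).prod_fiberwise
    fun k => hasSum_coord_sq (slice x k)

/-- The operator `X ⊗ 1`, with its norm bound. -/
theorem exists_op_tensor_one (X : Op γ) (κ : Type*) [DecidableEq κ] :
    ∃ Z : Op (γ × κ), ‖Z‖ ≤ ‖X‖ ∧
      ∀ p q, entry Z p q = if p.2 = q.2 then entry X p.1 q.1 else 0 := by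
  have hb : ∀ (x : Hilb (γ × κ)) k, ‖X (slice x k)‖ ^ 2 ≤ ‖X‖ ^ 2 * ‖slice x k‖ ^ 2 := by
    intro x k
    rw [← mul_pow]
    exact pow_le_pow_left₀ (norm_nonneg _) (X.le_opNorm _) 2
  have hs : ∀ x : Hilb (γ × κ), Summable fun k => ‖X (slice x k)‖ ^ 2 := fun x =>
    Summable.of_nonneg_of_le (fun _ => sq_nonneg _) (hb x)
      ((hasSum_norm_slice_sq x).summable.mul_left _)
  have hsum : ∀ x : Hilb (γ × κ), Summable fun p : γ × κ => ‖coord (X (slice x p.2)) p.1‖ ^ 2 := by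
    intro x
    refine (Equiv.prodComm κ γ).summable_iff.1 ?_
    refine (summable_prod_of_nonneg fun _ => sq_nonneg _).2
      ⟨fun k => summable_coord (X (slice x k)), (hs x).congr fun k => ?_⟩
    exact (hasSum_coord_sq (X (slice x k))).tsum_eq.symm
  let L : Hilb (γ × κ) →ₗ[ℂ] Hilb (γ × κ) :=
    { toFun := fun x => vecOf (fun p => coord (X (slice x p.2)) p.1) (hsum x)
      map_add' := fun x y => hilb_ext fun p => by
        have e : slice (x + y) p.2 = slice x p.2 + slice y p.2 := rfl
        rw [coord_add, coord_vecOf, coord_vecOf, coord_vecOf, e, map_add, coord_add]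
      map_smul' := fun c x => hilb_ext fun p => by
        have e : slice (c • x) p.2 = c • slice x p.2 := rfl
        rw [coord_smul, coord_vecOf, coord_vecOf, e, map_smul, coord_smul,
          RingHom.id_apply] }
  have hLs : ∀ x k, slice (L x) k = X (slice x k) := fun x k => rfl
  have hL : ∀ x, ‖L x‖ ≤ ‖X‖ * ‖x‖ := fun x => by
    refine (sq_le_sq₀ (norm_nonneg _) (by positivity)).1 ?_
    rw [mul_pow]
    refine hasSum_le (hb x) ?_ ((hasSum_norm_slice_sq x).mul_left _)
    exact hasSum_norm_slice_sq (L x)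
  refine ⟨L.mkContinuous _ hL, L.mkContinuous_norm_le (norm_nonneg _) _, fun p q => ?_⟩
  have e1 : entry (L.mkContinuous _ hL) p q = coord (X (slice (ket (γ × κ) q) p.2)) p.1 := by
    rw [entry, ← coord_eq_inner]
    rfl
  classical
  have e2 : slice (ket (γ × κ) q) p.2 = if p.2 = q.2 then ket γ q.1 else 0 := by
    refine hilb_ext fun g => ?_
    rw [coord_slice, coord_ket]
    split_ifs with h1 h2 h2
    · rw [coord_ket, if_pos (congrArg Prod.fst h1)]
    · exact absurd (congrArg Prod.snd h1) h2
    · rw [coord_ket, if_neg fun h => h1 (Prod.ext h h2)]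
    · rfl
  rw [e1, e2]
  split_ifs
  · exact coord_eq_inner _ _
  · rw [map_zero]
    rfl

theorem exists_op_reindex (e : γ ≃ κ) (T : Op γ) :
    ∃ Z : Op κ, ‖Z‖ ≤ ‖T‖ ∧ ∀ p q, entry Z p q = entry T (e.symm p) (e.symm q) := by
  have ho : Orthonormal ℂ fun k => ket γ (e.symm k) :=
    (ket γ).orthonormal.comp _ e.symm.injective
  have hd : ⊤ ≤ (Submodule.span ℂ (Set.range fun k => ket γ (e.symm k))).topologicalClosure := by
    have h := (ket γ).dense_span
    rw [← e.symm.surjective.range_comp] at h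
    exact h.ge
  let b : HilbertBasis κ ℂ (Hilb γ) := HilbertBasis.mk ho hd
  let U : Hilb γ ≃ₗᵢ[ℂ] Hilb κ := b.repr
  have hU : ∀ k, U (ket γ (e.symm k)) = ket κ k := fun k => by
    classical
    have h1 : b k = ket γ (e.symm k) := congrFun (HilbertBasis.coe_mk ho hd) k
    have h2 : U (b k) = lp.single 2 k (1 : ℂ) := b.repr_self k
    have h3 : (ket κ).repr (ket κ k) = lp.single 2 k (1 : ℂ) := (ket κ).repr_self k
    rw [← h1, h2, ← h3]
    rfl
  refine ⟨(U : Hilb γ →L[ℂ] Hilb κ).comp (T.comp (U.symm : Hilb κ →L[ℂ] Hilb γ)), ?_,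
    fun p q => ?_⟩
  · refine ContinuousLinearMap.opNorm_le_bound _ (norm_nonneg _) fun x => ?_
    have h := T.le_opNorm (U.symm x)
    rw [LinearIsometryEquiv.norm_map] at h
    refine le_trans (le_of_eq ?_) h
    exact LinearIsometryEquiv.norm_map U _
  · rw [entry, entry, ← hU p, ← hU q]
    change ⟪U _, U (T (U.symm (U _)))⟫_ℂ = _
    rw [LinearIsometryEquiv.inner_map_map, LinearIsometryEquiv.symm_apply_apply]

/-- The operator `X ⊗ Y`, with its norm bound. -/
theorem exists_op_tensor (X : Op γ) (Y : Op κ) :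
    ∃ Z : Op (γ × κ), ‖Z‖ ≤ ‖X‖ * ‖Y‖ ∧
      ∀ p q, entry Z p q = entry X p.1 q.1 * entry Y p.2 q.2 := by
  classical
  obtain ⟨Z₁, hn₁, he₁⟩ := exists_op_tensor_one X κ
  obtain ⟨Z₂, hn₂, he₂⟩ := exists_op_tensor_one Y γ
  obtain ⟨Z₃, hn₃, he₃⟩ := exists_op_reindex (Equiv.prodComm κ γ) Z₂
  refine ⟨Z₁ * Z₃, (norm_mul_le _ _).trans (by gcongr; exact hn₃.trans hn₂), fun p q => ?_⟩
  rw [← (hasSum_entry_mul Z₁ Z₃ p q).tsum_eq, tsum_eq_single (q.1, p.2)]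
  · simp [he₁, he₂, he₃]
  · intro r hr
    rw [he₁]
    by_cases h1 : p.2 = r.2
    · have h2 : ¬((Equiv.prodComm κ γ).symm r).2 = ((Equiv.prodComm κ γ).symm q).2 :=
        fun h2 => hr (Prod.ext h2 h1.symm)
      rw [he₃, he₂, if_neg h2, mul_zero]
    · rw [if_neg h1, zero_mul]

/-- The operator `X^{⊗n}` on `ℓ²(γⁿ)`, with its norm bound. -/
theorem exists_op_pi (X : Op γ) (n : ℕ) :
    ∃ Z : Op (Fin n → γ), ‖Z‖ ≤ ‖X‖ ^ n ∧ ∀ p q, entry Z p q = ∏ k, entry X (p k) (q k) := by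
  induction n with
  | zero =>
    refine ⟨1, by rw [pow_zero]; exact ContinuousLinearMap.norm_id_le, fun p q => ?_⟩
    rw [Subsingleton.elim q p]
    simp [entry, (ket _).orthonormal.1 p]
  | succ n ih =>
    obtain ⟨Y, hY, hYe⟩ := ih
    obtain ⟨Z, hZ, hZe⟩ := exists_op_tensor X Y
    obtain ⟨W, hW, hWe⟩ := exists_op_reindex (Fin.consEquiv fun _ => γ) Z
    refine ⟨W, hW.trans (hZ.trans ?_), fun p q => ?_⟩
    · rw [pow_succ']
      gcongr
    · rw [hWe, hZe, hYe, Fin.prod_univ_succ]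
      rfl

/-- The product of absolutely convergent series, as a series over tuples. -/
theorem hasSum_pi_prod {n : ℕ} (f : Fin n → γ → ℂ) (hf : ∀ k, Summable fun g => ‖f k g‖) :
    Summable (fun p : Fin n → γ => ‖∏ k, f k (p k)‖) ∧
      ∑' p : Fin n → γ, ∏ k, f k (p k) = ∏ k, ∑' g, f k g := by
  induction n with
  | zero => exact ⟨(hasSum_fintype _).summable, by simp [tsum_fintype]⟩
  | succ n ih =>
    obtain ⟨h1, h2⟩ := ih (fun k => f k.succ) fun k => hf k.succ
    have e : ∀ r : γ × (Fin n → γ), ∏ k, f k (Fin.consEquiv (fun _ => γ) r k)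
        = f 0 r.1 * ∏ k : Fin n, f k.succ (r.2 k) := fun r => by
      rw [Fin.prod_univ_succ]
      rfl
    constructor
    · refine (Fin.consEquiv fun _ => γ).summable_iff.1 ?_
      refine ((hf 0).mul_norm h1).congr fun r => ?_
      rw [Function.comp_apply, e]
    · rw [← (Fin.consEquiv fun _ => γ).tsum_eq, Fin.prod_univ_succ, ← h2,
        tsum_mul_tsum_of_summable_norm (hf 0) h1]
      exact tsum_congr e

variable {α β : Type*}

theorem exists_tensorPow (X : Op (α × β)) (n : ℕ) :
    ∃ Z : Op ((Fin n → α) × (Fin n → β)), ‖Z‖ ≤ ‖X‖ ^ n ∧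
      ∀ p q, entry Z p q = ∏ k, entry X (p.1 k, p.2 k) (q.1 k, q.2 k) := by
  obtain ⟨Y, hY, hYe⟩ := exists_op_pi X n
  obtain ⟨Z, hZ, hZe⟩ := exists_op_reindex
    (Equiv.arrowProdEquivProdArrow (Fin n) (fun _ => α) fun _ => β) Y
  exact ⟨Z, hZ.trans hY, fun p q => (hZe p q).trans (hYe _ _)⟩

/-- The matrix of `X^{⊗n}`, for an arbitrary bounded operator `X`. -/
theorem entry_tensorPow_of_bounded (X : Op (α × β)) (n : ℕ) (p q : (Fin n → α) × (Fin n → β)) :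
    entry (tensorPow X n) p q = ∏ k, entry X (p.1 k, p.2 k) (q.1 k, q.2 k) :=
  entry_ofMatrix (m := fun p q : (Fin n → α) × (Fin n → β) =>
    ∏ k, entry X (p.1 k, p.2 k) (q.1 k, q.2 k))
    ((exists_tensorPow X n).imp fun _ h => h.2) p q

theorem norm_tensorPow_le (X : Op (α × β)) (n : ℕ) : ‖tensorPow X n‖ ≤ ‖X‖ ^ n := by
  obtain ⟨Z, hZ, hZe⟩ := exists_tensorPow X n
  have : tensorPow X n = Z :=
    ext_entry fun p q => (entry_tensorPow_of_bounded X n p q).trans (hZe p q).symm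
  rwa [this]

theorem star_tensorPow (X : Op (α × β)) (n : ℕ) :
    star (tensorPow X n) = tensorPow (star X) n := by
  refine ext_entry fun p q => ?_
  simp only [entry_star, entry_tensorPow_of_bounded, star_prod]

theorem tensorPow_mul (X Y : Op (α × β)) (n : ℕ) :
    tensorPow X n * tensorPow Y n = tensorPow (X * Y) n := by
  refine ext_entry fun p q => ?_
  rw [← (hasSum_entry_mul _ _ p q).tsum_eq, entry_tensorPow_of_bounded]
  have h := (hasSum_pi_prod (fun (k : Fin n) r =>
    entry X (p.1 k, p.2 k) r * entry Y r (q.1 k, q.2 k))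
    fun k => (hasSum_entry_mul X Y _ _).summable.norm).2
  simp only [(hasSum_entry_mul X Y _ _).tsum_eq] at h
  rw [← h, ← (Equiv.arrowProdEquivProdArrow (Fin n) (fun _ => α) fun _ => β).tsum_eq]
  refine tsum_congr fun r => ?_
  rw [entry_tensorPow_of_bounded, entry_tensorPow_of_bounded, ← Finset.prod_mul_distrib]
  rfl

theorem hasSum_entry_tensorPow {T : Op (α × β)} (hT : Summable fun p => ‖entry T p p‖) (n : ℕ) :
    HasSum (fun p => entry (tensorPow T n) p p) (tr T ^ n) := by
  obtain ⟨h1, h2⟩ := hasSum_pi_prod (fun (_ : Fin n) r => entry T r r) fun _ => hT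
  have h3 := h1.of_norm.hasSum
  rw [h2, Fin.prod_const] at h3
  refine (Equiv.arrowProdEquivProdArrow (Fin n) (fun _ => α) fun _ => β).hasSum_iff.1
    (h3.congr_fun fun r => ?_)
  rw [Function.comp_apply, entry_tensorPow_of_bounded]
  rfl

/-- `Tr X^{⊗n} T^{⊗n} = (Tr X T)^n`. -/
theorem tr_tensorPow_mul (X : Op (α × β)) {T : Op (α × β)} (hT : T ∈ TraceClass (α × β)) (n : ℕ) :
    tr (tensorPow X n * tensorPow T n) = tr (X * T) ^ n := by
  rw [tensorPow_mul]
  exact (hasSum_entry_tensorPow (summable_norm_entry_mul X hT) n).tsum_eq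

theorem IsState.tensorPow {ρ : Op (α × β)} (h : IsState ρ) (n : ℕ) : IsState (tensorPow ρ n) := by
  have hsum := hasSum_entry_tensorPow (summable_entry_diag h.2.1).norm n
  have hpos : 0 ≤ Ent.tensorPow ρ n := by
    -- The tensor power of `ρ = √ρ† √ρ` has the form `S† S` with `S = √ρ^{⊗n}`.
    have e : ρ = star (CFC.sqrt ρ) * CFC.sqrt ρ := by
      rw [(CFC.sqrt_nonneg ρ).isSelfAdjoint.star_eq, CFC.sqrt_mul_sqrt_self ρ h.1]
    rw [e, ← tensorPow_mul, ← star_tensorPow]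
    exact star_mul_self_nonneg _
  refine ⟨hpos, mem_traceClass_of_nonneg hpos hsum.summable, ?_⟩
  rw [tr, hsum.tsum_eq, h.2.2, one_pow]

theorem IsPartialTranspose.tensorPow {X Y : Op (α × β)} (h : IsPartialTranspose X Y) (n : ℕ) :
    IsPartialTranspose (tensorPow X n) (tensorPow Y n) := fun a b a' b' => by
  rw [entry_tensorPow_of_bounded, entry_tensorPow_of_bounded]
  exact Finset.prod_congr rfl fun k _ => h _ _ _ _

end TensorPower

/-! ### Separable operators are PPT -/

section Separable

variable {α β : Type*}

theorem coord_tensorVec (ψ : Hilb α) (φ : Hilb β) (p : α × β) :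
    coord (tensorVec ψ φ) p = coord ψ p.1 * coord φ p.2 := rfl

theorem norm_tensorVec (ψ : Hilb α) (φ : Hilb β) : ‖tensorVec ψ φ‖ = ‖ψ‖ * ‖φ‖ := by
  have h1 := hasSum_coord_sq (tensorVec ψ φ)
  simp only [coord_tensorVec, norm_mul, mul_pow] at h1
  have h2 := (hasSum_coord_sq ψ).mul (hasSum_coord_sq φ)
    ((summable_coord ψ).mul_of_nonneg (summable_coord φ) (fun _ => sq_nonneg _)
      fun _ => sq_nonneg _)
  have h3 := h1.unique h2
  rw [← mul_pow] at h3
  exact (sq_eq_sq₀ (norm_nonneg _) (by positivity)).1 h3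

/-- The partial transpose of a product projection is again a product projection. -/
theorem exists_isPartialTranspose_proj_tensorVec (ψ : Hilb α) (φ : Hilb β) :
    ∃ φ' : Hilb β, IsPartialTranspose (proj (tensorVec ψ φ)) (proj (tensorVec ψ φ')) := by
  refine ⟨vecOf (fun b => star (coord φ b)) (by simpa using summable_coord φ),
    fun a b a' b' => ?_⟩
  simp only [entry_proj, coord_tensorVec, coord_vecOf, star_mul', star_star]
  ring

theorem smul_add_smul_mem_ppt {S T : Op (α × β)} (hS : S ∈ cone .ppt α β)
    (hT : T ∈ cone .ppt α β) {a b : ℝ} (ha : 0 ≤ a) (hb : 0 ≤ b) :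
    (a : ℂ) • S + (b : ℂ) • T ∈ cone .ppt α β := by
  refine ⟨add_mem (Submodule.smul_mem _ _ hS.1) (Submodule.smul_mem _ _ hT.1), ?_, ?_⟩
  · rw [Complex.coe_smul, Complex.coe_smul]
    exact add_nonneg (smul_nonneg ha hS.2.1) (smul_nonneg hb hT.2.1)
  · rw [ptranspose_smul_add_smul hS.1 hT.1, Complex.coe_smul, Complex.coe_smul]
    exact add_nonneg (smul_nonneg ha hS.2.2) (smul_nonneg hb hT.2.2)

theorem proj_tensorVec_mem_ppt (ψ : Hilb α) (φ : Hilb β) :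
    proj (tensorVec ψ φ) ∈ cone .ppt α β := by
  obtain ⟨φ', h⟩ := exists_isPartialTranspose_proj_tensorVec ψ φ
  refine ⟨proj_mem_traceClass _, proj_nonneg _, ?_⟩
  rw [h.ptranspose_eq (proj_mem_traceClass _)]
  exact proj_nonneg _

theorem convexHull_product_subset_ppt :
    convexHull ℝ {P : Op (α × β) | ∃ (ψ : Hilb α) (φ : Hilb β), ‖ψ‖ = 1 ∧ ‖φ‖ = 1 ∧
      P = proj (tensorVec ψ φ)} ⊆ cone .ppt α β := by
  refine convexHull_min ?_ fun S hS T hT a b ha hb _ => ?_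
  · rintro _ ⟨ψ, φ, -, -, rfl⟩
    exact proj_tensorVec_mem_ppt ψ φ
  · have h := smul_add_smul_mem_ppt hS hT ha hb
    rwa [Complex.coe_smul, Complex.coe_smul] at h

/-- Approximation in trace norm gives convergence of the matrix elements of `σ` and of `σ^Γ`, and
positivity passes to such limits. -/
theorem sepStates_subset_ppt : sepStates α β ⊆ cone .ppt α β := by
  intro σ hσ
  have hpos : ∀ n : ℕ, (0 : ℝ≥0∞) < ENNReal.ofReal (1 / ((n : ℝ) + 1)) := fun n =>
    ENNReal.ofReal_pos.2 (by positivity)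
  choose τ hτ hd using fun n => hσ _ (hpos n)
  have hp := fun n => convexHull_product_subset_ppt (hτ n)
  have hdiff : ∀ n, σ - τ n ∈ TraceClass (α × β) := fun n =>
    (hd n).trans ENNReal.ofReal_lt_top
  have hσt : σ ∈ TraceClass (α × β) := by
    rw [← sub_add_cancel σ (τ 0)]
    exact add_mem (hdiff 0) (hp 0).1
  have hlim : ∀ i j, Filter.Tendsto (fun n => entry (τ n) i j) Filter.atTop
      (nhds (entry σ i j)) := fun i j => by
    refine tendsto_iff_norm_sub_tendsto_zero.2 ?_
    refine squeeze_zero (fun _ => norm_nonneg _) (fun n => ?_)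
      (tendsto_one_div_add_atTop_nhds_zero_nat (𝕜 := ℝ))
    rw [norm_sub_rev, ← entry_sub]
    exact (norm_entry_le (hdiff n) i j).trans
      (ENNReal.toReal_le_of_le_ofReal (by positivity) (hd n).le)
  refine ⟨hσt, nonneg_of_tendsto_entry (fun n => (hp n).2.1) hlim,
    nonneg_of_tendsto_entry (fun n => (hp n).2.2) fun i j => ?_⟩
  rw [isPartialTranspose_ptranspose hσt i.1 i.2 j.1 j.2]
  refine (hlim _ _).congr fun n => ?_
  exact (isPartialTranspose_ptranspose (hp n).1 i.1 i.2 j.1 j.2).symm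

theorem cone_subset_ppt (K : Kind) : cone K α β ⊆ cone .ppt α β := by
  cases K with
  | ppt => exact subset_rfl
  | sep =>
    rintro _ ⟨l, hl, σ, hσ, rfl⟩
    have h := smul_add_smul_mem_ppt (sepStates_subset_ppt hσ) (sepStates_subset_ppt hσ) hl le_rfl
    rwa [Complex.ofReal_zero, zero_smul, add_zero] at h

theorem sepStates_subset_cone (K : Kind) : sepStates α β ⊆ cone K α β := by
  cases K with
  | ppt => exact sepStates_subset_ppt
  | sep => exact fun σ hσ => ⟨1, zero_le_one, σ, hσ, by simp⟩

/-- The uniform mixture of a finite family of pure product states. -/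
noncomputable def mixture {κ : Type*} [Fintype κ] (ψ : κ → Hilb α) (φ : κ → Hilb β) :
    Op (α × β) :=
  ((Fintype.card κ : ℝ)⁻¹ : ℝ) • ∑ k, proj (tensorVec (ψ k) (φ k))

section Mixture

variable {κ : Type*} [Fintype κ] {ψ : κ → Hilb α} {φ : κ → Hilb β}

theorem entry_mixture (ψ : κ → Hilb α) (φ : κ → Hilb β) (p q : α × β) :
    entry (mixture ψ φ) p q = (Fintype.card κ : ℂ)⁻¹ *
      ∑ k, coord (ψ k) p.1 * coord (φ k) p.2 * star (coord (ψ k) q.1 * coord (φ k) q.2) := by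
  have h : entry (∑ k, proj (tensorVec (ψ k) (φ k))) p q
      = ∑ k, entry (proj (tensorVec (ψ k) (φ k))) p q := by
    simp only [entry, sum_apply, inner_sum]
  rw [mixture, ← Complex.coe_smul, entry_smul, h]
  simp only [entry_proj, coord_tensorVec]
  push_cast
  rfl

variable [Nonempty κ]

theorem mixture_mem_sepStates (hψ : ∀ k, ‖ψ k‖ = 1) (hφ : ∀ k, ‖φ k‖ = 1) :
    mixture ψ φ ∈ sepStates α β := by
  refine fun ε hε => ⟨mixture ψ φ, ?_, by rwa [sub_self, traceNorm_zero]⟩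
  rw [mixture, Finset.smul_sum]
  refine (convex_convexHull ℝ _).sum_mem (fun _ _ => by positivity) (by simp) fun k _ => ?_
  exact subset_convexHull ℝ _ ⟨ψ k, φ k, hψ k, hφ k, rfl⟩

theorem isState_mixture (hψ : ∀ k, ‖ψ k‖ = 1) (hφ : ∀ k, ‖φ k‖ = 1) :
    IsState (mixture ψ φ) := by
  have hm := sepStates_subset_ppt (mixture_mem_sepStates hψ hφ)
  refine ⟨hm.2.1, hm.1, ?_⟩
  have h : HasSum (fun p => entry (mixture ψ φ) p p)
      ((Fintype.card κ : ℂ)⁻¹ * ∑ k, ((‖tensorVec (ψ k) (φ k)‖ ^ 2 : ℝ) : ℂ)) := by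
    have h1 := (hasSum_sum fun k (_ : k ∈ Finset.univ) =>
      hasSum_entry_proj (tensorVec (ψ k) (φ k))).mul_left (Fintype.card κ : ℂ)⁻¹
    refine h1.congr_fun fun p => ?_
    rw [entry_mixture]
    simp only [entry_proj, coord_tensorVec]
  rw [tr, h.tsum_eq]
  simp [norm_tensorVec, hψ, hφ]

end Mixture

end Separable

/-! ### The maximally entangled state as a combination of separable states -/

section MaximallyEntangled

variable {ι : Type*} [Fintype ι]

/-- The unit vector with coordinates `χ (g a) / √d`, where `χ` is the standard character
of `ZMod 3`. -/
noncomputable def phaseVec (g : ι → ZMod 3) : Hilb ι :=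
  vecOf (fun a => (((√(Fintype.card ι))⁻¹ : ℝ) : ℂ) * ZMod.stdAddChar (g a))
    (hasSum_fintype _).summable

theorem norm_phaseVec [Nonempty ι] (g : ι → ZMod 3) : ‖phaseVec g‖ = 1 := by
  have h := (hasSum_coord_sq (phaseVec g)).tsum_eq
  have hd : (Fintype.card ι : ℝ) ≠ 0 := by positivity
  rw [tsum_fintype] at h
  simp only [phaseVec, coord_vecOf, norm_mul, AddChar.norm_apply, Complex.norm_real, norm_inv,
    Real.norm_of_nonneg (Real.sqrt_nonneg _), mul_one, inv_pow,
    Real.sq_sqrt (Nat.cast_nonneg (α := ℝ) _), Finset.sum_const, Finset.card_univ, nsmul_eq_mul,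
    mul_inv_cancel₀ hd] at h
  exact (pow_eq_one_iff_of_nonneg (norm_nonneg _) two_ne_zero).1 h.symm

/-- Orthogonality of characters of `ι → ZMod 3`: the phase `χ (g a - g b - g a' + g b')` averages
to zero unless the multisets `{a, b'}` and `{b, a'}` coincide. -/
theorem sum_stdAddChar_eq_ite [DecidableEq ι] (a b a' b' : ι) :
    ∑ g : ι → ZMod 3, ZMod.stdAddChar (g a - g b - g a' + g b')
      = if (a = b ∧ a' = b') ∨ (a = a' ∧ b = b') then (Fintype.card (ι → ZMod 3) : ℂ) else 0 := by
  split_ifs with h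
  · have h0 : ∀ g : ι → ZMod 3, g a - g b - g a' + g b' = 0 := fun g => by
      rcases h with ⟨rfl, rfl⟩ | ⟨rfl, rfl⟩ <;> ring
    simp [h0]
  · let f : (ι → ZMod 3) →+ ZMod 3 :=
      Pi.evalAddMonoidHom (fun _ => ZMod 3) a - Pi.evalAddMonoidHom (fun _ => ZMod 3) b
        - Pi.evalAddMonoidHom (fun _ => ZMod 3) a' + Pi.evalAddMonoidHom (fun _ => ZMod 3) b'
    have hf : ∀ g, f g = g a - g b - g a' + g b' := fun g => rfl
    obtain ⟨g, hg⟩ : ∃ g, f g ≠ 0 := by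
      simp only [hf]
      by_cases h1 : a = b
      · subst h1
        refine ⟨Pi.single b' 1, ?_⟩
        have h2 : a' ≠ b' := fun h2 => h (Or.inl ⟨rfl, h2⟩)
        simp [h2]
      · by_cases h3 : a = a'
        · subst h3
          have h2 : b ≠ b' := fun h2 => h (Or.inr ⟨rfl, h2⟩)
          refine ⟨Pi.single b' 1, ?_⟩
          simp [h2]
        · refine ⟨Pi.single a 1, ?_⟩
          simp only [Pi.single_eq_same, Pi.single_eq_of_ne (Ne.symm h1),
            Pi.single_eq_of_ne (Ne.symm h3), sub_zero]
          by_cases h4 : b' = a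
          · subst h4
            simp only [Pi.single_eq_same]
            decide
          · simp [Pi.single_eq_of_ne h4]
    refine AddChar.sum_eq_zero_of_ne_one (ψ := (ZMod.stdAddChar (N := 3)).compAddMonoidHom f)
      fun h1 => hg (ZMod.injective_stdAddChar ?_)
    rw [AddChar.map_zero_eq_one]
    exact DFunLike.congr_fun h1 g

/-- Averaging the product vectors `v_g ⊗ v̄_g` over all phases `g` produces
`d⁻² (∑_{a,b} |ab⟩⟨ab| + ∑_{a≠a'} |aa⟩⟨a'a'|)`, which is the maximally entangled state up to
product states. -/
theorem exists_separable_decomposition [DecidableEq ι] [Nonempty ι] {T : Op (ι × ι)}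
    (hT : ∀ p q, entry T p q = if p.1 = p.2 ∧ q.1 = q.2 then (Fintype.card ι : ℂ)⁻¹ else 0) :
    ∃ E D M : Op (ι × ι), (E ∈ sepStates ι ι ∧ IsState E) ∧ (D ∈ sepStates ι ι ∧ IsState D) ∧
      (M ∈ sepStates ι ι ∧ IsState M) ∧
      T = (Fintype.card ι : ℂ) • E + D - (Fintype.card ι : ℂ) • M := by
  have hk : ∀ i, ‖ket ι i‖ = 1 := (ket ι).orthonormal.1
  have hd : (Fintype.card ι : ℂ) ≠ 0 := by simp
  have hd3 : (Fintype.card (ι → ZMod 3) : ℂ) ≠ 0 := by simp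
  have hsq : (((√(Fintype.card ι))⁻¹ : ℝ) : ℂ) ^ 2 = (Fintype.card ι : ℂ)⁻¹ := by
    rw [← Complex.ofReal_pow, inv_pow, Real.sq_sqrt (Nat.cast_nonneg _)]
    push_cast
    rfl
  refine ⟨mixture (fun g : ι → ZMod 3 => phaseVec g) fun g => phaseVec (-g),
    mixture (fun i : ι => ket ι i) fun i => ket ι i,
    mixture (fun r : ι × ι => ket ι r.1) fun r => ket ι r.2,
    ⟨mixture_mem_sepStates (fun _ => norm_phaseVec _) fun _ => norm_phaseVec _,
      isState_mixture (fun _ => norm_phaseVec _) fun _ => norm_phaseVec _⟩,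
    ⟨mixture_mem_sepStates (fun _ => hk _) fun _ => hk _,
      isState_mixture (fun _ => hk _) fun _ => hk _⟩,
    ⟨mixture_mem_sepStates (fun _ => hk _) fun _ => hk _,
      isState_mixture (fun _ => hk _) fun _ => hk _⟩, ext_entry ?_⟩
  rintro ⟨a, b⟩ ⟨a', b'⟩
  have hE : entry (mixture (fun g : ι → ZMod 3 => phaseVec g) fun g => phaseVec (-g))
      (a, b) (a', b') = if (a = b ∧ a' = b') ∨ (a = a' ∧ b = b') then
        (Fintype.card ι : ℂ)⁻¹ ^ 2 else 0 := by
    have e : ∀ g : ι → ZMod 3, coord (phaseVec g) a * coord (phaseVec (-g)) b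
        * star (coord (phaseVec g) a' * coord (phaseVec (-g)) b')
        = (Fintype.card ι : ℂ)⁻¹ ^ 2 * ZMod.stdAddChar (g a - g b - g a' + g b') := fun g => by
      rw [← hsq, sub_eq_add_neg, sub_eq_add_neg, AddChar.map_add_eq_mul, AddChar.map_add_eq_mul,
        AddChar.map_add_eq_mul]
      simp only [phaseVec, coord_vecOf, Pi.neg_apply, star_mul', Complex.star_def,
        Complex.conj_ofReal, AddChar.map_neg_eq_conj, Complex.conj_conj]
      ring
    rw [entry_mixture]
    simp only [e]
    rw [← Finset.mul_sum, sum_stdAddChar_eq_ite]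
    split_ifs
    · rw [mul_comm, mul_assoc, mul_inv_cancel₀ hd3, mul_one]
    · simp
  have hD : entry (mixture (fun i : ι => ket ι i) fun i => ket ι i) (a, b) (a', b')
      = if b = a ∧ a' = a ∧ b' = a then (Fintype.card ι : ℂ)⁻¹ else 0 := by
    rw [entry_mixture]
    simp only [coord_ket]
    rw [Finset.sum_eq_single a]
    · by_cases h1 : b = a <;> by_cases h2 : a' = a <;> by_cases h3 : b' = a <;>
        simp [h1, h2, h3]
    · intro i _ hi
      simp [Ne.symm hi]
    · simp
  have hM : entry (mixture (fun r : ι × ι => ket ι r.1) fun r => ket ι r.2) (a, b) (a', b')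
      = if a' = a ∧ b' = b then (Fintype.card ι : ℂ)⁻¹ ^ 2 else 0 := by
    rw [entry_mixture]
    simp only [coord_ket]
    rw [Finset.sum_eq_single (a, b)]
    · by_cases h1 : a' = a <;> by_cases h2 : b' = b <;> simp [h1, h2, sq]
    · rintro ⟨i, j⟩ _ hi
      by_cases h1 : a = i
      · have h2 : b ≠ j := fun h2 => hi (by rw [h1, h2])
        simp [h2]
      · simp [h1]
    · simp
  rw [hT, entry_sub, entry_add, entry_smul, entry_smul, hE, hD, hM]
  clear hT hk hsq hE hD hM
  simp only [eq_comm (a := b) (b := a), eq_comm (a := a') (b := a), eq_comm (a := b') (b := a),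
    eq_comm (a := b') (b := b)]
  by_cases h1 : a = b <;> by_cases h2 : a' = b' <;> by_cases h3 : a = a' <;>
    by_cases h4 : b = b' <;> simp_all
  field_simp

theorem entry_ebit (p q : Fin 2 × Fin 2) :
    entry ebit p q = if p.1 = p.2 ∧ q.1 = q.2 then (2 : ℂ)⁻¹ else 0 := by
  have hc : ∀ p : Fin 2 × Fin 2, coord (((1 / √2 : ℝ) : ℂ) •
      (ket (Fin 2 × Fin 2) (0, 0) + ket (Fin 2 × Fin 2) (1, 1))) p
      = if p.1 = p.2 then ((1 / √2 : ℝ) : ℂ) else 0 := by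
    rintro ⟨i, j⟩
    rw [coord_smul, coord_add, coord_ket, coord_ket]
    fin_cases i <;> fin_cases j <;> simp
  have hs : ((1 / √2 : ℝ) : ℂ) * ((1 / √2 : ℝ) : ℂ) = (2 : ℂ)⁻¹ := by
    rw [← Complex.ofReal_mul, div_mul_div_comm, Real.mul_self_sqrt zero_le_two]
    norm_num
  rw [ebit, entry_proj, hc, hc]
  split_ifs with h1 h2 h3 h3 <;> simp_all

theorem entry_ebits (k : ℕ) (p q : (Fin k → Fin 2) × (Fin k → Fin 2)) :
    entry (ebits k : Op ((Fin k → Fin 2) × (Fin k → Fin 2))) p q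
      = if p.1 = p.2 ∧ q.1 = q.2 then (Fintype.card (Fin k → Fin 2) : ℂ)⁻¹ else 0 := by
  change entry (tensorPow ebit k) p q = _
  rw [entry_tensorPow_of_bounded]
  simp only [entry_ebit]
  split_ifs with h
  · rw [Finset.prod_congr rfl fun j _ => if_pos ⟨congrFun h.1 j, congrFun h.2 j⟩]
    simp
  · have h' : ∃ j, ¬(p.1 j = p.2 j ∧ q.1 j = q.2 j) := by
      by_contra hc
      push Not at hc
      exact h ⟨funext fun j => (hc j).1, funext fun j => (hc j).2⟩
    obtain ⟨j, hj⟩ := h'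
    exact Finset.prod_eq_zero (Finset.mem_univ j) (if_neg hj)

end MaximallyEntangled

/-! ### Bounds on the witnesses -/

section Witness

variable {α β : Type*}

theorem abs_tr_mul_le_of_stdRobustness {K : Kind} {X T : Op (α × β)} {δ : ℝ}
    (hX : X ∈ dualInterval K α β) (hT : T ∈ TraceClass (α × β)) (htr : tr T = 1) (hδ : 0 ≤ δ)
    (h : stdRobustness K T ≤ ENNReal.ofReal δ) : |(tr (X * T)).re| ≤ 1 + 2 * δ := by
  refine le_of_forall_pos_le_add fun η hη => ?_
  have hlt : stdRobustness K T < ENNReal.ofReal (δ + η / 2) :=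
    h.trans_lt ((ENNReal.ofReal_lt_ofReal_iff (by positivity)).2 (by linarith))
  obtain ⟨⟨D, hD, hTD⟩, hlt⟩ := iInf_lt_iff.1 hlt
  have hDt := (cone_subset_ppt K hD).1
  have h1 : (tr D).re < δ + η / 2 := (ENNReal.ofReal_lt_ofReal_iff (by positivity)).1 hlt
  have h2 := abs_le.1 (hX.2 D hD)
  have h3 := abs_le.1 (hX.2 (T + D) hTD)
  rw [tr_mul_add X hT hDt, tr_add hT hDt, htr] at h3
  simp only [Complex.add_re, Complex.one_re] at h3
  rw [abs_le]
  constructor <;> linarith [h2.1, h2.2, h3.1, h3.2]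

theorem abs_tr_mul_le_of_negativity {X Y T : Op (α × β)} {δ : ℝ} (hXY : IsPartialTranspose X Y)
    (hY : ‖Y‖ ≤ 1) (hT : T ∈ TraceClass (α × β)) (h0 : 0 ≤ T) (hδ : 0 ≤ δ)
    (h : negativity T ≤ ENNReal.ofReal δ) : |(tr (X * T)).re| ≤ 1 + 2 * δ := by
  have h1 : traceNorm (ptranspose T) ≤ ENNReal.ofReal (1 + 2 * δ) := by
    rw [negativity, ENNReal.div_le_iff_le_mul (Or.inl two_ne_zero) (Or.inl ENNReal.ofNat_ne_top),
      tsub_le_iff_right] at h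
    rw [ENNReal.ofReal_add zero_le_one (by positivity), ENNReal.ofReal_mul zero_le_two,
      ENNReal.ofReal_one, ENNReal.ofReal_ofNat, add_comm, mul_comm]
    exact h
  have hS : ptranspose T ∈ TraceClass (α × β) := h1.trans_lt ENNReal.ofReal_lt_top
  rw [tr_mul_eq_of_isPartialTranspose hXY (isPartialTranspose_ptranspose hT) h0.isSelfAdjoint
    hT hS]
  refine (Complex.abs_re_le_norm _).trans ((norm_tr_mul_le Y hS).trans ?_)
  exact (mul_le_of_le_one_left ENNReal.toReal_nonneg hY).trans
    (ENNReal.toReal_le_of_le_ofReal (by positivity) h1)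

/-- If `X` is bounded by `c` on the images of all free states, then it is bounded by
`(2 · 2ᵏ + 1) c` on the image of `k` entanglement bits, whose distance from a state `ω` with
`Tr X ω = ‖X‖` costs at most `2 ε ‖X‖`. -/
theorem one_sub_mul_norm_le {K : Kind} {k : ℕ}
    {Λ : TraceClass ((Fin k → Fin 2) × (Fin k → Fin 2)) →ₗ[ℂ] TraceClass (α × β)}
    {X ω : Op (α × β)} {c ε : ℝ} (hω : ω ∈ TraceClass (α × β)) (hX : (‖X‖ : ℂ) = tr (X * ω))
    (hΛ : ∀ σ : TraceClass ((Fin k → Fin 2) × (Fin k → Fin 2)),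
      (σ : Op ((Fin k → Fin 2) × (Fin k → Fin 2))) ∈ cone K _ _ →
      IsState (σ : Op ((Fin k → Fin 2) × (Fin k → Fin 2))) →
      |(tr (X * (Λ σ : Op (α × β)))).re| ≤ c)
    (hε : 0 ≤ ε) (herr : traceNorm ((Λ (ebits k) : Op (α × β)) - ω) / 2 ≤ ENNReal.ofReal ε) :
    (1 - 2 * ε) * ‖X‖ ≤ (2 * 2 ^ k + 1) * c := by
  obtain ⟨E, D, M, ⟨hE, hEs⟩, ⟨hD, hDs⟩, ⟨hM, hMs⟩, hdec⟩ :=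
    exists_separable_decomposition (entry_ebits k)
  have hd : (Fintype.card (Fin k → Fin 2) : ℂ) = ((2 ^ k : ℝ) : ℂ) := by simp
  have hdec' : ebits k = (Fintype.card (Fin k → Fin 2) : ℂ) • ⟨E, hEs.2.1⟩ + ⟨D, hDs.2.1⟩
      - (Fintype.card (Fin k → Fin 2) : ℂ) • ⟨M, hMs.2.1⟩ := Subtype.ext hdec
  -- The bounds on the three separable terms add up to `d c + c + d c` with `d = 2ᵏ`.
  have hE' := abs_le.1 (hΛ ⟨E, hEs.2.1⟩ (sepStates_subset_cone K hE) hEs)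
  have hD' := abs_le.1 (hΛ ⟨D, hDs.2.1⟩ (sepStates_subset_cone K hD) hDs)
  have hM' := abs_le.1 (hΛ ⟨M, hMs.2.1⟩ (sepStates_subset_cone K hM) hMs)
  have hup : (tr (X * (Λ (ebits k) : Op (α × β)))).re ≤ (2 * 2 ^ k + 1) * c := by
    rw [hdec', map_sub, map_add, map_smul, map_smul, Submodule.coe_sub, Submodule.coe_add,
      Submodule.coe_smul, Submodule.coe_smul,
      tr_mul_sub X (add_mem (Submodule.smul_mem _ _ (Subtype.prop _)) (Subtype.prop _))
        (Submodule.smul_mem _ _ (Subtype.prop _)),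
      tr_mul_add X (Submodule.smul_mem _ _ (Subtype.prop _)) (Subtype.prop _), tr_mul_smul,
      tr_mul_smul, hd, Complex.sub_re, Complex.add_re, Complex.re_ofReal_mul,
      Complex.re_ofReal_mul]
    have h2 : (0 : ℝ) ≤ 2 ^ k := by positivity
    linarith [mul_le_mul_of_nonneg_left hE'.2 h2, mul_le_mul_of_nonneg_left hM'.1 h2, hD'.2]
  have herr' : traceNorm ((Λ (ebits k) : Op (α × β)) - ω) ≤ ENNReal.ofReal (2 * ε) := by
    rw [ENNReal.div_le_iff_le_mul (Or.inl two_ne_zero) (Or.inl ENNReal.ofNat_ne_top)] at herr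
    rwa [ENNReal.ofReal_mul zero_le_two, ENNReal.ofReal_ofNat, mul_comm]
  have hdiff : (Λ (ebits k) : Op (α × β)) - ω ∈ TraceClass (α × β) :=
    sub_mem (Subtype.prop _) hω
  have hlow : ‖X‖ - (tr (X * (Λ (ebits k) : Op (α × β)))).re ≤ ‖X‖ * (2 * ε) := by
    have h1 : ‖X‖ = (tr (X * ω)).re := by rw [← hX, Complex.ofReal_re]
    have h2 := tr_mul_sub X (Subtype.prop (Λ (ebits k))) hω
    have h3 : (tr (X * ω)).re - (tr (X * (Λ (ebits k) : Op (α × β)))).re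
        = -(tr (X * ((Λ (ebits k) : Op (α × β)) - ω))).re := by
      rw [h2, Complex.sub_re]
      ring
    calc _ = -(tr (X * ((Λ (ebits k) : Op (α × β)) - ω))).re := by rw [← h3, ← h1]
      _ ≤ ‖tr (X * ((Λ (ebits k) : Op (α × β)) - ω))‖ :=
        (neg_le_abs _).trans (Complex.abs_re_le_norm _)
      _ ≤ ‖X‖ * (traceNorm ((Λ (ebits k) : Op (α × β)) - ω)).toReal := norm_tr_mul_le X hdiff
      _ ≤ _ := by
        gcongr
        exact ENNReal.toReal_le_of_le_ofReal (by positivity) herr'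
  linarith

/-- At an achievable rate `R` with error below `1/2`, the witnesses `X` of `ρ^{⊗n}` have norm
at most of the order of `2^{Rn} (1 + 2 δₙ)`. -/
theorem exists_eventually_norm_le {K : Kind}
    {M : ∀ n : ℕ, Op ((Fin n → α) × (Fin n → β)) → ℝ≥0∞} {δ : ℕ → ℝ} {ε R : ℝ} {ρ : Op (α × β)}
    (hρ : IsState ρ) (hδ : ∀ n, 0 ≤ δ n) (hε : ε ∈ Set.Ico (0 : ℝ) (1 / 2)) (hR : 0 < R)
    (hlim : Filter.limsup (fun n : ℕ =>
      dilutionError K (M n) (δ n) ⌊R * n⌋₊ (tensorPow ρ n)) Filter.atTop ≤ ENNReal.ofReal ε) :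
    ∃ C : ℝ, 0 < C ∧ ∀ᶠ n : ℕ in Filter.atTop, ∀ X : Op ((Fin n → α) × (Fin n → β)),
      (∀ T : Op ((Fin n → α) × (Fin n → β)), T ∈ TraceClass _ → 0 ≤ T → tr T = 1 →
        M n T ≤ ENNReal.ofReal (δ n) → |(tr (X * T)).re| ≤ 1 + 2 * δ n) →
      (‖X‖ : ℂ) = tr (X * tensorPow ρ n) → ‖X‖ ≤ C * 2 ^ (R * n) * (1 + 2 * δ n) := by
  -- Strictly between `ε` and `1/2` there is room for the limsup and for the infimum over maps.
  obtain ⟨ε', hεε', hε'⟩ := exists_between hε.2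
  have hε0 : 0 ≤ ε' := hε.1.trans hεε'.le
  have hpos : 0 < 1 - 2 * ε' := by linarith
  refine ⟨3 / (1 - 2 * ε'), by positivity, ?_⟩
  have hlt : Filter.limsup (fun n : ℕ =>
      dilutionError K (M n) (δ n) ⌊R * n⌋₊ (tensorPow ρ n)) Filter.atTop < ENNReal.ofReal ε' :=
    hlim.trans_lt ((ENNReal.ofReal_lt_ofReal_iff (hε.1.trans_lt hεε')).2 hεε')
  filter_upwards [Filter.eventually_lt_of_limsup_lt hlt] with n hn X hX hXn
  obtain ⟨⟨Λ, hΛ⟩, herr⟩ := iInf_lt_iff.1 hn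
  have h1 := one_sub_mul_norm_le (hρ.tensorPow n).2.1 hXn (fun σ hσ hσs =>
    hX (Λ σ) (Subtype.prop _) (hΛ.1.1 σ hσs.1) ((hΛ.1.2 σ).trans hσs.2.2) (hΛ.2 σ hσ hσs))
    hε0 herr.le
  have h2 : (2 : ℝ) ^ ⌊R * n⌋₊ ≤ 2 ^ (R * n) := by
    rw [← Real.rpow_natCast]
    exact Real.rpow_le_rpow_of_exponent_le one_le_two (Nat.floor_le (by positivity))
  have h3 : (1 : ℝ) ≤ 2 ^ (R * n) := Real.one_le_rpow one_le_two (by positivity)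
  have h4 : 0 ≤ 1 + 2 * δ n := by linarith [hδ n]
  have h5 : (1 - 2 * ε') * ‖X‖ ≤ 3 * 2 ^ (R * n) * (1 + 2 * δ n) :=
    h1.trans (mul_le_mul_of_nonneg_right (by linarith) h4)
  rw [div_mul_eq_mul_div, div_mul_eq_mul_div, le_div_iff₀ hpos]
  linarith

/-- The witnesses of the tempered negativity of `ρ` tensorize. -/
theorem norm_tensorPow_eq {X ρ : Op (α × β)} (hρ : IsState ρ) (hX : (‖X‖ : ℂ) = tr (X * ρ))
    (n : ℕ) : ‖tensorPow X n‖ = ‖X‖ ^ n ∧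
      (‖tensorPow X n‖ : ℂ) = tr (tensorPow X n * tensorPow ρ n) := by
  have htr : tr (tensorPow X n * tensorPow ρ n) = ((‖X‖ ^ n : ℝ) : ℂ) := by
    rw [tr_tensorPow_mul X hρ.2.1, ← hX]
    push_cast
    rfl
  have h := norm_tr_mul_le (tensorPow X n) (hρ.tensorPow n).2.1
  rw [htr, (hρ.tensorPow n).traceNorm_toReal, mul_one, Complex.norm_real,
    Real.norm_of_nonneg (by positivity)] at h
  have heq := le_antisymm (norm_tensorPow_le X n) h
  exact ⟨heq, by rw [htr, heq]⟩

theorem norm_tensorPow_le_one {Y : Op (α × β)} (hY : ‖Y‖ ≤ 1) (n : ℕ) : ‖tensorPow Y n‖ ≤ 1 :=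
  (norm_tensorPow_le Y n).trans (pow_le_one₀ (norm_nonneg _) hY)

theorem ofReal_norm_pow_le_temperedRobustness (K : Kind) {X Y ρ : Op (α × β)} (hρ : IsState ρ)
    (hs : IsSelfAdjoint X) (hXY : IsPartialTranspose X Y) (hY : ‖Y‖ ≤ 1)
    (hX : (‖X‖ : ℂ) = tr (X * ρ)) (n : ℕ) :
    ENNReal.ofReal (‖X‖ ^ n / 2) ≤ 1 + temperedRobustness K (tensorPow ρ n) (tensorPow ρ n) := by
  obtain ⟨h1, h2⟩ := norm_tensorPow_eq hρ hX n
  have hmem : tensorPow X n ∈ dualInterval K (Fin n → α) (Fin n → β) := by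
    refine ⟨?_, fun W hW => abs_tr_mul_le_of_mem_ppt (hXY.tensorPow n)
      (norm_tensorPow_le_one hY n) (cone_subset_ppt K hW)⟩
    rw [IsSelfAdjoint, star_tensorPow, hs.star_eq]
  set s : ℝ≥0∞ := ⨆ X : {X : Op ((Fin n → α) × (Fin n → β)) //
    X ∈ dualInterval K _ _ ∧ (‖X‖ : ℂ) = tr (X * tensorPow ρ n)},
    ENNReal.ofReal (tr ((X : Op _) * tensorPow ρ n)).re with hsd
  have h3 : ENNReal.ofReal (‖X‖ ^ n) ≤ s := by
    refine le_iSup_of_le ⟨tensorPow X n, hmem, h2⟩ ?_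
    rw [← h2, Complex.ofReal_re, h1]
  change _ ≤ 1 + (s - 1) / 2
  -- The subtraction truncates at zero, which only increases the right-hand side.
  rw [ENNReal.ofReal_div_of_pos two_pos, ENNReal.ofReal_ofNat]
  calc _ ≤ s / 2 := by gcongr
    _ ≤ (1 + (s - 1)) / 2 := by
      gcongr
      exact le_add_tsub
    _ = 1 / 2 + (s - 1) / 2 := ENNReal.add_div
    _ ≤ _ := by
      gcongr
      exact ENNReal.div_le_of_le_mul (by norm_num)

end Witness

/-! ### Asymptotics -/

section Asymptotics

theorem log2_mono {x y : ℝ≥0∞} (h : x ≤ y) : log2 x ≤ log2 y :=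
  EReal.div_le_div_right_of_nonneg (by exact_mod_cast (Real.log_pos one_lt_two).le)
    (ENNReal.log_monotone h)

theorem log2_ofReal {x : ℝ} (hx : 0 < x) : log2 (ENNReal.ofReal x) = (Real.logb 2 x : ℝ) := by
  rw [log2, ENNReal.log_ofReal_of_pos hx, ← EReal.coe_div]
  rfl

theorem log2_iSup_le {I : Type*} {f : I → ℝ≥0∞} {B : EReal} (h : ∀ i, log2 (f i) ≤ B) :
    log2 (⨆ i, f i) ≤ B := by
  have h2 : (0 : EReal) < (Real.log 2 : ℝ) := by exact_mod_cast Real.log_pos one_lt_two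
  have key : ∀ x, log2 x ≤ B ↔ x ≤ ENNReal.logOrderIso.symm ((Real.log 2 : ℝ) * B) := fun x => by
    rw [log2, EReal.div_le_iff_le_mul h2 (EReal.coe_ne_top _), OrderIso.le_symm_apply]
    rfl
  rw [key]
  exact iSup_le fun i => (key _).1 (h i)

theorem log2_ofReal_rpow_div {x : ℝ} {n : ℕ} (hn : n ≠ 0) :
    log2 (ENNReal.ofReal (2 ^ (x * n))) / (n : EReal) = (x : ℝ) := by
  have hn' : (n : ℝ) ≠ 0 := by exact_mod_cast hn
  rw [log2_ofReal (by positivity), Real.logb_rpow two_pos (by norm_num),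
    ← EReal.coe_natCast, ← EReal.coe_div, mul_div_cancel_right₀ x hn']

/-- Subexponential factors do not contribute to the exponential growth rate. -/
theorem limsup_log2_div_le {a : ℕ → ℝ≥0∞} {δ : ℕ → ℝ} {C R : ℝ}
    (hδ : ∀ k : ℝ, 0 < k → ∃ m : ℕ, ∀ n : ℕ, m ≤ n → δ n < (2 : ℝ) ^ (k * n)) (hC : 0 < C)
    (ha : ∀ᶠ n : ℕ in Filter.atTop, a n ≤ ENNReal.ofReal (C * 2 ^ (R * n) * (1 + 2 * δ n))) :
    Filter.limsup (fun n : ℕ => log2 (a n) / (n : EReal)) Filter.atTop ≤ (R : EReal) := by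
  have key : ∀ κ : ℝ, 0 < κ →
      Filter.limsup (fun n : ℕ => log2 (a n) / (n : EReal)) Filter.atTop
        ≤ ((R + 2 * κ : ℝ) : EReal) := by
    intro κ hκ
    obtain ⟨m, hm⟩ := hδ κ hκ
    have hlarge : ∀ᶠ n : ℕ in Filter.atTop, 3 * C ≤ (2 : ℝ) ^ (κ * n) := by
      have h1 : Filter.Tendsto (fun n : ℕ => ((2 : ℝ) ^ κ) ^ n) Filter.atTop Filter.atTop :=
        tendsto_pow_atTop_atTop_of_one_lt (Real.one_lt_rpow one_lt_two hκ)
      filter_upwards [h1.eventually_ge_atTop (3 * C)] with n hn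
      rwa [Real.rpow_mul zero_le_two, Real.rpow_natCast]
    refine Filter.limsup_le_of_le (by isBoundedDefault) ?_
    filter_upwards [ha, hlarge, Filter.eventually_ge_atTop m, Filter.eventually_ne_atTop 0]
      with n h1 h2 h3 h4
    have h5 : (1 : ℝ) ≤ 2 ^ (κ * n) := Real.one_le_rpow one_le_two (by positivity)
    have h6 : C * 2 ^ (R * n) * (1 + 2 * δ n) ≤ 2 ^ ((R + 2 * κ) * n) := by
      have e : (2 : ℝ) ^ ((R + 2 * κ) * n) = 2 ^ (R * n) * (2 ^ (κ * n) * 2 ^ (κ * n)) := by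
        rw [← Real.rpow_add two_pos, ← Real.rpow_add two_pos]
        congr 1
        ring
      calc C * 2 ^ (R * n) * (1 + 2 * δ n)
          ≤ C * 2 ^ (R * n) * (3 * 2 ^ (κ * n)) := by
            gcongr
            linarith [hm n h3]
        _ = 2 ^ (R * n) * (3 * C * 2 ^ (κ * n)) := by ring
        _ ≤ _ := by
          rw [e]
          gcongr
    rw [← log2_ofReal_rpow_div h4]
    exact EReal.div_le_div_right_of_nonneg (by positivity)
      (log2_mono (h1.trans (ENNReal.ofReal_le_ofReal h6)))
  refine EReal.le_of_forall_lt_iff_le.1 fun z hz => ?_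
  have hz' : R < z := by exact_mod_cast hz
  have h := key ((z - R) / 2) (by linarith)
  rwa [mul_div_cancel₀ _ two_ne_zero, add_sub_cancel] at h

theorem log2_ofReal_pow_div {t : ℝ} (ht : 0 < t) {n : ℕ} (hn : n ≠ 0) :
    log2 (ENNReal.ofReal (t ^ n)) / (n : EReal) = log2 (ENNReal.ofReal t) := by
  have hn' : (n : ℝ) ≠ 0 := by exact_mod_cast hn
  rw [log2_ofReal (by positivity), log2_ofReal ht, Real.logb_pow, ← EReal.coe_natCast,
    ← EReal.coe_div, mul_div_cancel_left₀ _ hn']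

theorem le_limsup_log2_div {a : ℕ → ℝ≥0∞} {t : ℝ} (ht : 0 < t)
    (ha : ∀ n, ENNReal.ofReal (t ^ n / 2) ≤ a n) :
    log2 (ENNReal.ofReal t)
      ≤ Filter.limsup (fun n : ℕ => log2 (a n) / (n : EReal)) Filter.atTop := by
  have hlim : Filter.Tendsto (fun n : ℕ => ((Real.logb 2 t - 1 / (n : ℝ) : ℝ) : EReal))
      Filter.atTop (nhds (log2 (ENNReal.ofReal t))) := by
    rw [log2_ofReal ht]
    refine (continuous_coe_real_ereal.tendsto _).comp ?_
    simpa using (tendsto_const_nhds (x := Real.logb 2 t)).sub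
      (tendsto_one_div_atTop_nhds_zero_nat (𝕜 := ℝ))
  rw [← hlim.limsup_eq]
  refine Filter.limsup_le_limsup ?_
  filter_upwards [Filter.eventually_ne_atTop 0] with n hn
  have hn' : (n : ℝ) ≠ 0 := by exact_mod_cast hn
  have e : ((Real.logb 2 t - 1 / (n : ℝ) : ℝ) : EReal)
      = log2 (ENNReal.ofReal (t ^ n / 2)) / (n : EReal) := by
    rw [log2_ofReal (by positivity), Real.logb_div (by positivity) two_ne_zero, Real.logb_pow,
      Real.logb_self_eq_one one_lt_two, ← EReal.coe_natCast, ← EReal.coe_div]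
    congr 1
    field_simp
  rw [e]
  exact EReal.div_le_div_right_of_nonneg (by positivity) (log2_mono (ha n))

end Asymptotics

/-! ### The lower bounds on the entanglement cost -/

section Bounds

variable {α β : Type*}

theorem temperedRobustnessRate_le_of_achievable {K : Kind} {δ : ℕ → ℝ} {ε R : ℝ} {ρ : Op (α × β)}
    (hρ : IsState ρ) (hδ_nonneg : ∀ n, 0 ≤ δ n)
    (hδ : ∀ k : ℝ, 0 < k → ∃ m : ℕ, ∀ n : ℕ, m ≤ n → δ n < (2 : ℝ) ^ (k * n))
    (hε : ε ∈ Set.Ico (0 : ℝ) (1 / 2)) (hR : 0 < R)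
    (hlim : Filter.limsup (fun n : ℕ =>
      dilutionError K (stdRobustness K) (δ n) ⌊R * n⌋₊ (tensorPow ρ n)) Filter.atTop
        ≤ ENNReal.ofReal ε) :
    temperedRobustnessRate K ρ ≤ (R : EReal) := by
  obtain ⟨C, hC, h⟩ := exists_eventually_norm_le (M := fun _ => stdRobustness K) hρ hδ_nonneg
    hε hR hlim
  refine limsup_log2_div_le hδ (C := 1 + C) (by positivity) ?_
  filter_upwards [h] with n hn
  have h1 : (1 : ℝ) ≤ 2 ^ (R * n) := Real.one_le_rpow one_le_two (by positivity)
  have h2 : 1 ≤ 2 ^ (R * n) * (1 + 2 * δ n) :=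
    one_le_mul_of_one_le_of_one_le h1 (by linarith [hδ_nonneg n])
  have h3 : 0 ≤ C * 2 ^ (R * n) * (1 + 2 * δ n) := by
    rw [mul_assoc]
    exact mul_nonneg hC.le (zero_le_one.trans h2)
  calc 1 + temperedRobustness K (tensorPow ρ n) (tensorPow ρ n)
      ≤ 1 + ENNReal.ofReal (C * 2 ^ (R * n) * (1 + 2 * δ n)) := by
        gcongr
        refine ENNReal.div_le_of_le_mul (tsub_le_self.trans (iSup_le fun X => ?_))
        rw [← X.2.2, Complex.ofReal_re]
        refine (ENNReal.ofReal_le_ofReal (hn X (fun T hT _ htr hM =>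
          abs_tr_mul_le_of_stdRobustness X.2.1 hT htr (hδ_nonneg n) hM) X.2.2)).trans ?_
        exact le_mul_of_one_le_right' one_le_two
    _ = ENNReal.ofReal (1 + C * 2 ^ (R * n) * (1 + 2 * δ n)) := by
        rw [ENNReal.ofReal_add zero_le_one h3, ENNReal.ofReal_one]
    _ ≤ _ := ENNReal.ofReal_le_ofReal (by linarith)

/-- A bound on the tempered logarithmic negativity has to be checked on its witnesses only. -/
theorem temperedLogNegativity_le {ρ : Op (α × β)} {B : EReal}
    (h : ∀ X Y : Op (α × β), IsSelfAdjoint X → IsPartialTranspose X Y → ‖Y‖ ≤ 1 →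
      (‖X‖ : ℂ) = tr (X * ρ) → 0 < ‖X‖ → log2 (ENNReal.ofReal ‖X‖) ≤ B) :
    temperedLogNegativity ρ ≤ B := by
  refine log2_iSup_le fun X => ?_
  obtain ⟨X, hs, ⟨Y, hXY, hY⟩, hX⟩ := X
  change log2 (ENNReal.ofReal (tr (X * ρ)).re) ≤ B
  rw [← hX, Complex.ofReal_re]
  rcases (norm_nonneg X).eq_or_lt with h0 | h0
  · rw [← h0, ENNReal.ofReal_zero, log2, ENNReal.log_zero,
      EReal.bot_div_of_pos_ne_top (by exact_mod_cast Real.log_pos one_lt_two)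
        (EReal.coe_ne_top _)]
    exact bot_le
  · exact h X Y hs hXY hY hX h0

theorem temperedLogNegativity_le_temperedRobustnessRate (K : Kind) {ρ : Op (α × β)}
    (hρ : IsState ρ) : temperedLogNegativity ρ ≤ temperedRobustnessRate K ρ :=
  temperedLogNegativity_le fun _ _ hs hXY hY hX h0 =>
    le_limsup_log2_div h0 (ofReal_norm_pow_le_temperedRobustness K hρ hs hXY hY hX)

theorem temperedLogNegativity_le_of_achievable {K : Kind} {δ : ℕ → ℝ} {ε R : ℝ} {ρ : Op (α × β)}
    (hρ : IsState ρ) (hδ_nonneg : ∀ n, 0 ≤ δ n)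
    (hδ : ∀ k : ℝ, 0 < k → ∃ m : ℕ, ∀ n : ℕ, m ≤ n → δ n < (2 : ℝ) ^ (k * n))
    (hε : ε ∈ Set.Ico (0 : ℝ) (1 / 2)) (hR : 0 < R)
    (hlim : Filter.limsup (fun n : ℕ =>
      dilutionError K negativity (δ n) ⌊R * n⌋₊ (tensorPow ρ n)) Filter.atTop
        ≤ ENNReal.ofReal ε) :
    temperedLogNegativity ρ ≤ (R : EReal) := by
  obtain ⟨C, hC, h⟩ := exists_eventually_norm_le (M := fun _ => negativity) hρ hδ_nonneg hε hR hlim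
  refine temperedLogNegativity_le fun X Y hs hXY hY hX h0 => ?_
  have h1 : Filter.limsup (fun n : ℕ => log2 (ENNReal.ofReal (‖X‖ ^ n)) / (n : EReal))
      Filter.atTop = log2 (ENNReal.ofReal ‖X‖) := by
    rw [Filter.limsup_congr (Filter.eventually_ne_atTop 0 |>.mono fun n hn =>
      log2_ofReal_pow_div h0 hn), Filter.limsup_const]
  rw [← h1]
  refine limsup_log2_div_le hδ hC ?_
  filter_upwards [h] with n hn
  obtain ⟨h2, h3⟩ := norm_tensorPow_eq hρ hX n
  rw [← h2]
  exact ENNReal.ofReal_le_ofReal (hn _ (fun T hT hT0 _ hM => abs_tr_mul_le_of_negativity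
    (hXY.tensorPow n) (norm_tensorPow_le_one hY n) hT hT0 (hδ_nonneg n) hM) h3)

end Bounds

end Ent

theorem theoremS4 {α β : Type*} [Countable α] [Countable β] (K : Ent.Kind)
    (ρ : Ent.Op (α × β)) (hρ : Ent.IsState ρ)
    (δ : ℕ → ℝ) (hδ_nonneg : ∀ n, 0 ≤ δ n)
    (hδ : ∀ k : ℝ, 0 < k → ∃ m : ℕ, ∀ n : ℕ, m ≤ n → δ n < (2 : ℝ) ^ (k * n)) :
    (Ent.temperedRobustnessRate K ρ
        ≤ ⨅ ε : Set.Ico (0 : ℝ) (1 / 2), Ent.costRobustness K δ ε ρ) ∧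
      Ent.temperedLogNegativity ρ ≤ Ent.temperedRobustnessRate K ρ ∧
      (Ent.temperedLogNegativity ρ
        ≤ ⨅ ε : Set.Ico (0 : ℝ) (1 / 2), Ent.costNegativity K δ ε ρ) := by
  refine ⟨le_iInf fun ε => le_iInf fun R => ?_,
    Ent.temperedLogNegativity_le_temperedRobustnessRate K hρ,
    le_iInf fun ε => le_iInf fun R => ?_⟩
  · exact Ent.temperedRobustnessRate_le_of_achievable hρ hδ_nonneg hδ ε.2 R.2.1 R.2.2
  · exact Ent.temperedLogNegativity_le_of_achievable hρ hδ_nonneg hδ ε.2 R.2.1 R.2.2
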